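/- **Setting.** Let $x=(x_k)_{k\ge1}$ and $z=(z_k)_{k\ge1}$ be real-valued, zero-mean, jointly Gaussian, jointly stationary processes, and write $x_a^b=(x_i)_{\max(a,1)\le i\le b}$, $x^b=x_1^b$ (similarly for $z$). Fix $m\ge1$ and assume that * $z$ is partially Markov of order $m$: for all $k\ge1$, $P(z_{k+1}\mid x^k,z^k)=P(z_{k+1}\mid x^k_{k-m+1},z^k_{k-m+1})$ almost surely; * for every $k\ge m$ there is no deterministic relationship between the components of $[x^k_{k-m+1}\;\;z^k]$, i.e. no nontrivial linear combination of them is almost surely constant (their covariance matrix is positive definite). One says that $x$ *Granger causes* $z$ if for some $k\ge m$ the conditional distributions $P(z_{k+1}\mid x^k_{k-m+1},z^k_{k-m+1})$ and $P(z_{k+1}\mid z^k)$ differ with nonzero probability. For step sizes $\Delta_x,\Delta_z>0$ let $x^Q_k$ and $z^Q_k$ be obtained by infinite-level uniform quantization, i.e. by rounding $x_k$ to the nearest integer multiple of $\Delta_x$ and $z_k$ to the nearest integer multiple of $\Delta_z$. For $m\le q\le k$ let $$C^{x^Q\to z^Q}(m,q)=\big[\,\Gamma_{{z^*}^Q,\tilde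 x^Q}\;\;\Gamma_{{z^*}^Q,\tilde z^Q}\;\;\Gamma_{{z^*}^Q,{z^o}^Q}\,\big]\in\mathbb R^{(m+1)\times(m+q)}$$ be the matrix of cross-covariances of the quantized variables, where $z^*=z_{k-m+1}^{k+1}$, $\tilde x=x_{k-m+1}^{k}$, $\tilde z=z_{k-m+1}^{k}$, $z^o=z_{k-q+1}^{k-m}$, and let $\sigma^Q_{\min}$ be its smallest singular value. Let $\gamma_x,\gamma_z$ be the standard deviations of $x_k,z_k$, and put $k_x=\Delta_x/\gamma_x$, $k_z=\Delta_z/\gamma_z$. Assume a priori bounds $0<\underline\gamma_x\le\gamma_x\le\overline\gamma_x$, $0<\underline\gamma_z\le\gamma_z\le\overline\gamma_z$ and, for all $i,j\ge1$, $|\mathrm{Cov}(x_i,z_j)|\le\overline\gamma_{xz}$, $|\mathrm{Corr}(x_i,z_j)|\le\overline\rho_{xz}<1$, and $|\mathrm{Corr}(z_i,z_j)|\le\overline\rho_{zz}<1$ if $i\ne j$. **Proposition.** For all integers $q\ge m\ge1$ and all constants $\underline\gamma_x,\overline\gamma_x,\underline\gamma_z,\overline\gamma_z,\overline\gamma_{xz},\overline\rho_{xz},\overline\rho_{zz}$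 with $\underline\gamma_x,\underline\gamma_z>0$ and $\overline\rho_{xz},\overline\rho_{zz}<1$, there are $K>0$ and $\delta>0$, depending only on $m$, $q$ and these constants, such that the following holds for all processes $x,z$ as above satisfying these bounds, all $k\ge q$ and all $0<\Delta_x,\Delta_z<\delta$. If $C^{x^Q\to z^Q}(m,q)$ has full rank $m+1$ and $$4(m+1)\,\overline\gamma_{xz}\exp\Big(-\frac{2\pi^2\underline\gamma_x^2}{\Delta_x^2}\Big)+\frac{\Delta_z^2}{12}+d(\Delta_x,\Delta_z)<\sigma^Q_{\min},$$ where $$d(\Delta_x,\Delta_z)=\Big(4(m+1)\overline\gamma_{xz}e^{-2\pi^2/k_x^2}+\frac{\Delta_z^2}{12}\Big)^{1/2}K\max\Big\{e^{-\pi^2/k_z^2},\;(k_xk_z)^{1/2}e^{-\pi^2(1-\overline\rho_{xz})\left(\frac1{k_x^2}+\frac1{k_z^2}\right)},\;k_z\,e^{-\frac{2\pi^2}{k_z^2}(1-\overline\rho_{zz})}\Big\},$$ then $x$ Granger causes $z$. -/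

import Mathlib

open MeasureTheory ProbabilityTheory

namespace GrangerQuantized

/-- The segment `x_a, …, x_b` of a process with time axis `1, 2, …` (a process is a map
`x : ℕ → Ω → ℝ` whose value at time `0` is never used), as one random vector. Indices below `1`
are cut off, so `seg x a b` is `x_1, …, x_b` when `a ≤ 1`, and it is empty when `b < a`
or `b < 1`. -/
def seg {Ω : Type*} (x : ℕ → Ω → ℝ) (a b : ℕ) (ω : Ω) : Finset.Icc (max 1 a) b → ℝ :=
  fun i => x i ω

/-- `z` is partially Markov of order `m` in `x` and `z`: for all `k ≥ 1`, with probability one,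
`P(z_{k+1} | x^k, z^k) = P(z_{k+1} | x^k_{k-m+1}, z^k_{k-m+1})`. -/
def PartiallyMarkov {Ω : Type*} [MeasurableSpace Ω] (P : Measure Ω) [IsFiniteMeasure P]
    (x z : ℕ → Ω → ℝ) (m : ℕ) : Prop :=
  ∀ k : ℕ, 1 ≤ k → ∀ᵐ ω ∂P,
    condDistrib (z (k + 1)) (fun ω => (seg x 1 k ω, seg z 1 k ω)) P
        (seg x 1 k ω, seg z 1 k ω) =
      condDistrib (z (k + 1)) (fun ω => (seg x (k + 1 - m) k ω, seg z (k + 1 - m) k ω)) P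
        (seg x (k + 1 - m) k ω, seg z (k + 1 - m) k ω)

/-- `x` Granger causes `z` (with order `m`): it is not the case that, for all `k ≥ m`,
`P(z_{k+1} | x^k_{k-m+1}, z^k_{k-m+1}) = P(z_{k+1} | z^k)` with probability one. -/
def GrangerCauses {Ω : Type*} [MeasurableSpace Ω] (P : Measure Ω) [IsFiniteMeasure P]
    (x z : ℕ → Ω → ℝ) (m : ℕ) : Prop :=
  ¬ ∀ k : ℕ, m ≤ k → ∀ᵐ ω ∂P,
    condDistrib (z (k + 1)) (fun ω => (seg x (k + 1 - m) k ω, seg z (k + 1 - m) k ω)) P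
        (seg x (k + 1 - m) k ω, seg z (k + 1 - m) k ω) =
      condDistrib (z (k + 1)) (seg z 1 k) P (seg z 1 k ω)

/-- The two processes `(x_k)_{k ≥ 1}` and `(z_k)_{k ≥ 1}` are jointly Gaussian. -/
def JointlyGaussian {Ω : Type*} [MeasurableSpace Ω] (P : Measure Ω) (x z : ℕ → Ω → ℝ) : Prop :=
  IsGaussianProcess (Sum.elim (fun n : ℕ => x (n + 1)) (fun n : ℕ => z (n + 1))) P

/-- The two processes are jointly (strictly) stationary: the law of the whole trajectory
`(x_k, z_k)_{k ≥ 1}` is invariant under time shifts. -/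
def JointlyStationary {Ω : Type*} [MeasurableSpace Ω] (P : Measure Ω) (x z : ℕ → Ω → ℝ) : Prop :=
  ∀ h : ℕ, P.map (fun ω (n : ℕ) => (x (n + 1 + h) ω, z (n + 1 + h) ω)) =
    P.map (fun ω (n : ℕ) => (x (n + 1) ω, z (n + 1) ω))

/-- There is no deterministic relationship between the components of
`[x^k_{k-m+1}, z^k]`, at any time `k ≥ m`: no nontrivial affine relation between them holds almost
surely (the variables being jointly Gaussian, this says that their covariance matrix is
positive definite). -/
def NoDeterministicRelation {Ω : Type*} [MeasurableSpace Ω] (P : Measure Ω)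
    (x z : ℕ → Ω → ℝ) (m : ℕ) : Prop :=
  ∀ k : ℕ, m ≤ k → ∀ (a b : ℕ → ℝ) (c : ℝ),
    (∀ᵐ ω ∂P, ∑ i ∈ Finset.Icc (k + 1 - m) k, a i * x i ω +
        ∑ i ∈ Finset.Icc 1 k, b i * z i ω = c) →
      (∀ i ∈ Finset.Icc (k + 1 - m) k, a i = 0) ∧ (∀ i ∈ Finset.Icc 1 k, b i = 0)

/-- The standing assumption on the pair of scalar signals `x`, `z`: jointly Gaussian, jointly
stationary, `z` partially Markov of order `m` in `x` and `z`, and no deterministic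
relationship between the components of `[x^k_{k-m+1}, z^k]` for `k ≥ m`. -/
structure SignalPair {Ω : Type*} [MeasurableSpace Ω] (P : Measure Ω) [IsFiniteMeasure P]
    (x z : ℕ → Ω → ℝ) (m : ℕ) : Prop where
  measurable_x : ∀ k, 1 ≤ k → Measurable (x k)
  measurable_z : ∀ k, 1 ≤ k → Measurable (z k)
  gaussian : JointlyGaussian P x z
  stationary : JointlyStationary P x z
  markov : PartiallyMarkov P x z m
  nondegenerate : NoDeterministicRelation P x z m

/-- Infinite-level uniform (mid-tread) quantizer with step `Δ`: round to the nearest integer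
multiple of `Δ`. -/
noncomputable def quantize (Δ w : ℝ) : ℝ := Δ * (round (w / Δ) : ℝ)

/-- The quantized version of a process. -/
noncomputable def quantizeProcess {Ω : Type*} (Δ : ℝ) (x : ℕ → Ω → ℝ) : ℕ → Ω → ℝ :=
  fun k ω => quantize Δ (x k ω)

/-- The `(m+1) × (m + ℓ)` matrix `[Γ_{z*,x~}  Γ_{z*,z~}  Γ_{z*,zo}]` formed at time `k ≥ ℓ ≥ m`,
where `z* = z^{k+1}_{k-m+1}`, `x~ = x^k_{k-m+1}`, `z~ = z^k_{k-m+1}`, `zo = z^{k-m}_{k-ℓ+1}`. -/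
noncomputable def causalityMatrix {Ω : Type*} [MeasurableSpace Ω] (P : Measure Ω)
    (x z : ℕ → Ω → ℝ) (m ℓ k : ℕ) : Matrix (Fin (m + 1)) (Fin m ⊕ Fin m ⊕ Fin (ℓ - m)) ℝ :=
  fun i => Sum.elim
    (fun j => covariance (z (k - m + 1 + i)) (x (k - m + 1 + j)) P)
    (Sum.elim
      (fun j => covariance (z (k - m + 1 + i)) (z (k - m + 1 + j)) P)
      (fun j => covariance (z (k - m + 1 + i)) (z (k - ℓ + 1 + j)) P))

/-- Smallest singular value of a real matrix with `r` rows and `c` columns, i.e. the last one in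
the decreasing list `σ_0 ≥ σ_1 ≥ …` of its `min r c` singular values. -/
noncomputable def sigmaMin {ι κ : Type*} [Fintype ι] [Fintype κ] [DecidableEq κ]
    (A : Matrix ι κ ℝ) : ℝ :=
  (Matrix.toEuclideanLin A).singularValues (min (Fintype.card ι) (Fintype.card κ) - 1)

/-- Standard deviation. -/
noncomputable def stdDev {Ω : Type*} [MeasurableSpace Ω] (P : Measure Ω) (u : Ω → ℝ) : ℝ :=
  √(variance u P)

/-- Correlation coefficient. -/
noncomputable def corr {Ω : Type*} [MeasurableSpace Ω] (P : Measure Ω) (u v : Ω → ℝ) : ℝ :=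
  covariance u v P / (stdDev P u * stdDev P v)

/-- A priori bounds on the second-order statistics of `x` and `z`: the standard deviations lie in
`[sxLo, sxUp]` and `[szLo, szUp]`, the cross-covariances between `x` and `z` are bounded by `gxz`,
the cross-correlation coefficients by `ρxz`, and the autocorrelation coefficients of `z` at
nonzero lags by `ρzz`. -/
structure APrioriBounds {Ω : Type*} [MeasurableSpace Ω] (P : Measure Ω) (x z : ℕ → Ω → ℝ)
    (sxLo sxUp szLo szUp gxz ρxz ρzz : ℝ) : Prop where
  std_x : ∀ k, 1 ≤ k → sxLo ≤ stdDev P (x k) ∧ stdDev P (x k) ≤ sxUp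
  std_z : ∀ k, 1 ≤ k → szLo ≤ stdDev P (z k) ∧ stdDev P (z k) ≤ szUp
  cov_xz : ∀ i j, 1 ≤ i → 1 ≤ j → |covariance (x i) (z j) P| ≤ gxz
  corr_xz : ∀ i j, 1 ≤ i → 1 ≤ j → |corr P (x i) (z j)| ≤ ρxz
  corr_zz : ∀ i j, 1 ≤ i → 1 ≤ j → i ≠ j → |corr P (z i) (z j)| ≤ ρzz

/-- The expression inside the `O(·)` of the higher-order term, as a function of the relative
steps `kx = Δ_x / γ_x` and `kz = Δ_z / γ_z`. -/
noncomputable def orderTerm (kx kz ρxz ρzz : ℝ) : ℝ :=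
  max (Real.exp (-(Real.pi ^ 2 / kz ^ 2)))
    (max (√(kx * kz) * Real.exp (-(Real.pi ^ 2 * (1 - ρxz) * (1 / kx ^ 2 + 1 / kz ^ 2))))
      (kz * Real.exp (-(2 * Real.pi ^ 2 / kz ^ 2 * (1 - ρzz)))))

/-- The higher-order term `d(Δ_x, Δ_z)`, with `K` the constant implied by `O(·)`. -/
noncomputable def dTerm (K : ℝ) (m : ℕ) (gxz ρxz ρzz kx kz Δz : ℝ) : ℝ :=
  √(4 * (m + 1) * gxz * Real.exp (-(2 * Real.pi ^ 2 / kx ^ 2)) + Δz ^ 2 / 12) *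
    (K * orderTerm kx kz ρxz ρzz)

end GrangerQuantized

/-! The argument is by contraposition. If `x` does not Granger cause `z`, the regression of
`z_{k+1}` on the window of both signals agrees almost surely with its regression on `z^k`.
Nondegeneracy makes the coefficients agree, so only `z_{k-m+1}, …, z_k` enter, and the residual is
orthogonal to the whole `z^k` and to the window of `x` (`exists_normal_equations`). Hence the last
row of the unquantized causality matrix `C` is a combination of the other rows, and `C` has rank at
most `m`. On a unit vector of `ker C` the quantized matrix acts as the error `C^Q - C`, so a
suitable choice of that vector bounds `σ^Q_min` by the size of the error
(`exists_sigmaMin_le_norm`).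

The error is computed entrywise. Quantization adds a sawtooth of the signal, and Gaussian
expectations of its Fourier harmonics are exponentially small. With `M` denoting `orderTerm`, an
`x`-`z` entry moves by at most `4 γ_xz e^{-2π²/k_x²} + O(M²)`, a `z`-`z` entry at distinct times by
`O(M²)`, and a variance of `z` by `Δ_z²/12 + O(M²)`. Summing over blocks
(`norm_blockMatrix_apply_le`) gives the two leading terms of the criterion plus `O(M²)`.

Finally `M² ≤ const · √(…) · M`: `M` is at most a constant times `k_z` (`orderTerm_le`), while the
square root in `d` is at least `Δ_z/√12`. This product form is `d(Δ_x, Δ_z)`. -/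

namespace GrangerQuantized

open Real Filter Topology

/-! ### Fourier series of the rounding error and of its square. -/

/-- The rounding error of the mid-tread quantizer with step `1`. -/
noncomputable def sawtooth (u : ℝ) : ℝ := round u - u

/-- The Abel means of the Fourier series of `sawtooth`, in closed form. -/
noncomputable def abelSawtooth (r u : ℝ) : ℝ :=
  -(1 / π) * Complex.arg (1 + r * Complex.exp ((2 * π * u : ℝ) * Complex.I))

lemma abs_sawtooth_le (u : ℝ) : |sawtooth u| ≤ 1 / 2 := by
  rw [sawtooth, abs_sub_comm]; exact abs_sub_round u

lemma measurable_sawtooth : Measurable sawtooth := by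
  unfold sawtooth
  simp only [round_eq]
  fun_prop

lemma measurable_abelSawtooth (r : ℝ) : Measurable (abelSawtooth r) := by
  unfold abelSawtooth
  fun_prop

/-- Imaginary part of the Taylor series of `log (1 + r e^{2πiu})`. The term `n = 0` vanishes because
division by zero gives `0`. -/
lemma hasSum_abelSawtooth {r : ℝ} (hr0 : 0 ≤ r) (hr1 : r < 1) (u : ℝ) :
    HasSum (fun n : ℕ => (-1) ^ n * r ^ n * (sin (2 * π * n * u) / (π * n)))
      (abelSawtooth r u) := by
  have hz : ‖(r : ℂ) * Complex.exp ((2 * π * u : ℝ) * Complex.I)‖ < 1 := by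
    rw [norm_mul, Complex.norm_exp_ofReal_mul_I, mul_one, Complex.norm_real, norm_of_nonneg hr0]
    exact hr1
  have h := (Complex.hasSum_im (Complex.hasSum_taylorSeries_log hz)).mul_left (-(1 / π))
  rw [Complex.log_im] at h
  refine h.congr_fun fun n => ?_
  have e : Complex.exp ((2 * π * u : ℝ) * Complex.I) ^ n
      = Complex.exp ((2 * π * n * u : ℝ) * Complex.I) := by
    rw [← Complex.exp_nat_mul]; congr 1; push_cast; ring
  have e2 : ((-1) ^ (n + 1) * ((r : ℂ) * Complex.exp ((2 * π * u : ℝ) * Complex.I)) ^ n / n)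
      = (((-1) ^ (n + 1) * r ^ n / n : ℝ) : ℂ) * Complex.exp ((2 * π * n * u : ℝ) * Complex.I) := by
    rw [mul_pow, e]; push_cast; ring
  rw [e2, Complex.im_ofReal_mul, Complex.exp_ofReal_mul_I_im, pow_succ]
  rcases Nat.eq_zero_or_pos n with rfl | hn
  · simp
  · field_simp

/-- For `r < 1` the point `1 + r e^{iθ}` lies in the right half plane. The bound is uniform in `r`,
as dominated convergence for `r → 1` requires. -/
lemma abs_abelSawtooth_le {r : ℝ} (hr0 : 0 ≤ r) (hr1 : r < 1) (u : ℝ) :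
    |abelSawtooth r u| ≤ 1 / 2 := by
  have h : |Complex.arg (1 + r * Complex.exp ((2 * π * u : ℝ) * Complex.I))| < π / 2 := by
    rw [Complex.abs_arg_lt_pi_div_two_iff]
    left
    rw [Complex.add_re, Complex.one_re, Complex.re_ofReal_mul, Complex.exp_ofReal_mul_I_re]
    nlinarith [neg_one_le_cos (2 * π * u)]
  rw [abelSawtooth, abs_mul, abs_neg, abs_of_pos (by positivity)]
  have := pi_pos
  rw [one_div, inv_mul_le_iff₀ this]
  linarith

/-- With `t = u - round u`, one has `1 + e^{2πit} = 2 cos(πt) e^{iπt}`, of argument `πt` when `|t| <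
1/2`. At a rounding tie this point is `0` and the argument jumps. -/
lemma tendsto_abelSawtooth {u : ℝ} (hu : |u - round u| < 1 / 2) :
    Tendsto (fun r => abelSawtooth r u) (𝓝[<] 1) (𝓝 (sawtooth u)) := by
  set t := u - round u with ht
  have hπ := pi_pos
  obtain ⟨h1, h2⟩ := abs_lt.1 hu
  have hcos : 0 < cos (π * t) := cos_pos_of_mem_Ioo ⟨by nlinarith, by nlinarith⟩
  have hexp : Complex.exp ((2 * π * u : ℝ) * Complex.I)
      = Complex.exp ((2 * π * t : ℝ) * Complex.I) := by
    rw [Complex.exp_eq_exp_iff_exists_int]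
    exact ⟨round u, by rw [ht]; push_cast; ring⟩
  have hval : 1 + (1 : ℝ) * Complex.exp ((2 * π * u : ℝ) * Complex.I) =
      ((2 * cos (π * t) : ℝ) : ℂ) *
        (Complex.cos (π * t : ℝ) + Complex.sin (π * t : ℝ) * Complex.I) := by
    rw [hexp, Complex.exp_mul_I, show (2 * π * t : ℝ) = 2 * (π * t) by ring]
    apply Complex.ext
    · simp [← Complex.ofReal_cos, ← Complex.ofReal_sin, -Complex.ofReal_mul]
      rw [cos_two_mul]; ring
    · simp [← Complex.ofReal_cos, ← Complex.ofReal_sin, -Complex.ofReal_mul]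
      rw [sin_two_mul]; ring
  have harg : Complex.arg (1 + (1 : ℝ) * Complex.exp ((2 * π * u : ℝ) * Complex.I)) = π * t := by
    rw [hval]
    exact Complex.arg_mul_cos_add_sin_mul_I (by positivity) ⟨by nlinarith, by nlinarith⟩
  have hslit : 1 + (1 : ℝ) * Complex.exp ((2 * π * u : ℝ) * Complex.I) ∈ Complex.slitPlane := by
    left
    rw [hval, Complex.re_ofReal_mul, ← Complex.ofReal_cos, ← Complex.ofReal_sin]
    simp only [Complex.add_re, Complex.ofReal_re, Complex.mul_re, Complex.I_re, mul_zero,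
      Complex.ofReal_im, Complex.I_im, mul_one, sub_self, add_zero]
    positivity
  have hc : ContinuousAt (fun r : ℝ => abelSawtooth r u) 1 := by
    unfold abelSawtooth
    refine ContinuousAt.mul continuousAt_const ?_
    refine ContinuousAt.comp (f := fun r : ℝ => 1 + (r : ℂ) *
      Complex.exp ((2 * π * u : ℝ) * Complex.I)) (g := Complex.arg)
      (Complex.continuousAt_arg hslit) ?_
    fun_prop
  have : abelSawtooth 1 u = sawtooth u := by
    rw [abelSawtooth, harg, sawtooth, ht]; field_simp; ring
  rw [← this]
  exact hc.tendsto.mono_left nhdsWithin_le_nhds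

/-- Fourier series of the second Bernoulli polynomial at `u - round u + 1/2`; the shift by `1/2`
produces the signs `(-1)^n`. -/
lemma hasSum_sawtooth_sq (u : ℝ) :
    HasSum (fun n : ℕ => (-1) ^ n * (cos (2 * π * n * u) / (π * n) ^ 2))
      (sawtooth u ^ 2 - 1 / 12) := by
  obtain ⟨h1, h2⟩ := abs_le.1 (abs_sub_round u)
  have h := (hasSum_one_div_nat_pow_mul_cos one_ne_zero
    (x := u - round u + 1 / 2) ⟨by linarith, by linarith⟩).mul_left (1 / π ^ 2)
  have hb : (Polynomial.map (algebraMap ℚ ℝ) (Polynomial.bernoulli (2 * 1))).eval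
      (u - round u + 1 / 2) = (u - round u) ^ 2 - 1 / 12 := by
    simp [Polynomial.bernoulli, Finset.sum_range_succ, bernoulli_one, bernoulli_two]
    ring
  rw [hb] at h
  convert! h using 1
  · funext n
    have : cos (2 * π * n * (u - round u + 1 / 2)) = (-1) ^ n * cos (2 * π * n * u) := by
      rw [show 2 * π * n * (u - round u + 1 / 2)
        = 2 * π * n * u + n * π - ((n * round u : ℤ) : ℝ) * (2 * π) by push_cast; ring,
        cos_sub_int_mul_two_pi, cos_add_nat_mul_pi]
    rw [this, mul_one 2]
    field_simp
  · rw [sawtooth]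
    have := pi_pos
    norm_num [Nat.factorial]
    field_simp
    ring

variable {Ω : Type*} [MeasurableSpace Ω] {P : Measure Ω}

/-- An integral against the rounding error is controlled by the integrals against the
harmonics of its Fourier series. -/
lemma abs_integral_mul_sawtooth_le {g u : Ω → ℝ} (hg : Integrable g P) (hu : Measurable u)
    (hhalf : ∀ᵐ ω ∂P, |u ω - round (u ω)| < 1 / 2) {B : ℕ → ℝ} (hsum : Summable B)
    (hB : ∀ n : ℕ, |∫ ω, g ω * sin (2 * π * n * u ω) ∂P| / (π * n) ≤ B n) :
    |∫ ω, g ω * sawtooth (u ω) ∂P| ≤ ∑' n, B n := by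
  have hsin : ∀ n : ℕ, ∀ v : ℝ, |sin v / (π * n)| ≤ 1 := by
    intro n v
    rcases Nat.eq_zero_or_pos n with rfl | hn
    · simp
    · have : (1 : ℝ) ≤ n := by exact_mod_cast hn
      rw [abs_div, div_le_one (by positivity), abs_of_pos (by positivity : 0 < π * n)]
      nlinarith [abs_sin_le_one v, pi_gt_three]
  -- The sawtooth series does not converge absolutely, so it cannot be integrated termwise directly.
  -- The factor `r^n` permits this for the Abel means, with a bound that does not depend on `r`.
  have key : ∀ r : ℝ, 0 ≤ r → r < 1 → |∫ ω, g ω * abelSawtooth r (u ω) ∂P| ≤ ∑' n, B n := by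
    intro r h0 h1
    let F : ℕ → Ω → ℝ := fun n ω =>
      g ω * ((-1) ^ n * r ^ n * (sin (2 * π * n * u ω) / (π * n)))
    have hFb : ∀ n ω, ‖F n ω‖ ≤ r ^ n * |g ω| := by
      intro n ω
      simp only [F, norm_eq_abs, abs_mul, abs_pow, abs_neg, abs_one, one_pow, one_mul,
        abs_of_nonneg h0]
      have := mul_le_mul_of_nonneg_left (hsin n (2 * π * n * u ω)) (pow_nonneg h0 n)
      have := mul_le_mul_of_nonneg_left this (abs_nonneg (g ω))
      linarith
    have hFi : ∀ n, Integrable (F n) P := by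
      intro n
      refine (hg.abs.const_mul (r ^ n)).mono' ?_ (ae_of_all _ (hFb n))
      refine hg.aestronglyMeasurable.mul (Measurable.aestronglyMeasurable ?_)
      fun_prop
    have hsumF : Summable fun n => ∫ ω, ‖F n ω‖ ∂P := by
      refine Summable.of_nonneg_of_le (fun n => integral_nonneg fun ω => norm_nonneg _)
        (fun n => ?_) ((summable_geometric_of_lt_one h0 h1).mul_right (∫ ω, |g ω| ∂P))
      rw [← integral_const_mul]
      exact integral_mono (hFi n).norm (hg.abs.const_mul _) (hFb n)
    have hs := hasSum_integral_of_summable_integral_norm hFi hsumF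
    have htsum : ∀ ω, ∑' n, F n ω = g ω * abelSawtooth r (u ω) := fun ω =>
      ((hasSum_abelSawtooth h0 h1 (u ω)).mul_left (g ω)).tsum_eq
    simp only [htsum] at hs
    rw [← hs.tsum_eq, ← norm_eq_abs]
    refine tsum_of_norm_bounded hsum.hasSum fun n => ?_
    have : ∫ ω, F n ω ∂P
        = (-1) ^ n * r ^ n * ((∫ ω, g ω * sin (2 * π * n * u ω) ∂P) / (π * n)) := by
      rw [← integral_div, ← integral_const_mul]
      refine integral_congr_ae (ae_of_all _ fun ω => ?_)
      simp only [F]; ring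
    rw [this, norm_eq_abs, abs_mul, abs_mul, abs_pow, abs_pow, abs_neg, abs_one, one_pow, one_mul,
      abs_of_nonneg h0, abs_div, abs_of_nonneg (by positivity : 0 ≤ π * (n : ℝ))]
    refine le_trans ?_ (hB n)
    exact mul_le_of_le_one_left (by positivity) (pow_le_one₀ h0 h1.le)
  have hlim : Tendsto (fun r => ∫ ω, g ω * abelSawtooth r (u ω) ∂P) (𝓝[<] 1)
      (𝓝 (∫ ω, g ω * sawtooth (u ω) ∂P)) := by
    refine tendsto_integral_filter_of_dominated_convergence (fun ω => |g ω| * (1 / 2)) ?_ ?_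
      (hg.abs.mul_const _) ?_
    · exact Eventually.of_forall fun r => hg.aestronglyMeasurable.mul
        ((measurable_abelSawtooth r).comp hu).aestronglyMeasurable
    · filter_upwards [Ioo_mem_nhdsLT (show (0 : ℝ) < 1 by norm_num)] with r hr
      refine ae_of_all _ fun ω => ?_
      rw [norm_mul, norm_eq_abs, norm_eq_abs]
      exact mul_le_mul_of_nonneg_left (abs_abelSawtooth_le hr.1.le hr.2 _) (abs_nonneg _)
    · filter_upwards [hhalf] with ω hω
      exact (tendsto_abelSawtooth hω).const_mul _
  refine le_of_tendsto hlim.abs ?_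
  filter_upwards [Ioo_mem_nhdsLT (show (0 : ℝ) < 1 by norm_num)] with r hr
  exact key r hr.1.le hr.2

/-- Here the coefficients are `O(1/n²)`, so the series is integrated termwise without Abel means. -/
lemma abs_integral_sawtooth_sq_sub_le [IsProbabilityMeasure P] {u : Ω → ℝ} (hu : Measurable u)
    {B : ℕ → ℝ} (hsum : Summable B)
    (hB : ∀ n : ℕ, |∫ ω, cos (2 * π * n * u ω) ∂P| / (π * n) ^ 2 ≤ B n) :
    |∫ ω, sawtooth (u ω) ^ 2 ∂P - 1 / 12| ≤ ∑' n, B n := by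
  let F : ℕ → Ω → ℝ := fun n ω => (-1) ^ n * (cos (2 * π * n * u ω) / (π * n) ^ 2)
  have hFb : ∀ n ω, ‖F n ω‖ ≤ 1 / (n : ℝ) ^ 2 := by
    intro n ω
    simp only [F, norm_eq_abs, abs_mul, abs_pow, abs_neg, abs_one, one_pow, one_mul, abs_div]
    rcases Nat.eq_zero_or_pos n with rfl | hn
    · simp
    · have h1 : (1 : ℝ) ≤ n := by exact_mod_cast hn
      rw [abs_of_pos pi_pos, Nat.abs_cast]
      gcongr
      · exact abs_cos_le_one _
      · nlinarith [pi_gt_three]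
  have hFi : ∀ n, Integrable (F n) P := by
    intro n
    refine (integrable_const (1 / (n : ℝ) ^ 2)).mono' ?_ (ae_of_all _ (hFb n))
    refine Measurable.aestronglyMeasurable ?_
    fun_prop
  have hsumF : Summable fun n => ∫ ω, ‖F n ω‖ ∂P := by
    refine Summable.of_nonneg_of_le (fun n => integral_nonneg fun ω => norm_nonneg _)
      (fun n => ?_) (summable_one_div_nat_pow.2 one_lt_two)
    calc _ ≤ ∫ _, 1 / (n : ℝ) ^ 2 ∂P :=
          integral_mono (hFi n).norm (integrable_const _) (hFb n)
      _ = _ := by simp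
  have hs := hasSum_integral_of_summable_integral_norm hFi hsumF
  have htsum : ∀ ω, ∑' n, F n ω = sawtooth (u ω) ^ 2 - 1 / 12 := fun ω =>
    (hasSum_sawtooth_sq (u ω)).tsum_eq
  simp only [htsum] at hs
  have hint : Integrable (fun ω => sawtooth (u ω) ^ 2) P := by
    refine (integrable_const ((1 / 2 : ℝ) ^ 2)).mono'
      ((measurable_sawtooth.comp hu).pow_const 2).aestronglyMeasurable (ae_of_all _ fun ω => ?_)
    rw [norm_pow, norm_eq_abs]
    exact pow_le_pow_left₀ (abs_nonneg _) (abs_sawtooth_le _) 2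
  rw [integral_sub hint (integrable_const _)] at hs
  simp only [integral_const, probReal_univ, one_smul] at hs
  rw [← hs.tsum_eq, ← norm_eq_abs]
  refine tsum_of_norm_bounded hsum.hasSum fun n => ?_
  simp only [F]
  rw [integral_const_mul, integral_div, norm_eq_abs, abs_mul, abs_pow, abs_neg, abs_one, one_pow,
    one_mul, abs_div, abs_of_nonneg (by positivity : 0 ≤ (π * (n : ℝ)) ^ 2)]
  exact hB n

end GrangerQuantized

namespace GrangerQuantized

open Real Filter Topology

variable {Ω : Type*} [MeasurableSpace Ω] {P : Measure Ω}

/-! ### Trigonometric moments of centred Gaussian pairs. -/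

section Moments

lemma integral_cexp_mul_I_of_hasGaussianLaw {W : Ω → ℝ} (hW : HasGaussianLaw W P)
    (hmW : Measurable W) (h0 : ∫ ω, W ω ∂P = 0) :
    ∫ ω, Complex.exp (W ω * Complex.I) ∂P = (exp (-variance W P / 2) : ℝ) := by
  have h := hW.map_eq_gaussianReal
  have h1 := charFun_apply_real (μ := P.map W) 1
  rw [integral_map hmW.aemeasurable (by fun_prop), h, charFun_gaussianReal, h0] at h1
  simp only [Complex.ofReal_one, one_mul, Complex.ofReal_zero, mul_zero, zero_mul, one_pow,
    mul_one, zero_sub] at h1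
  rw [← h1, coe_toNNReal _ (variance_nonneg _ _)]
  push_cast
  congr 1
  ring

lemma integral_cos_of_hasGaussianLaw {W : Ω → ℝ} (hW : HasGaussianLaw W P)
    (hmW : Measurable W) (h0 : ∫ ω, W ω ∂P = 0) :
    ∫ ω, cos (W ω) ∂P = exp (-variance W P / 2) := by
  have := hW.isProbabilityMeasure
  have hi : Integrable (fun ω => Complex.exp (W ω * Complex.I)) P := by
    refine (integrable_const (1 : ℝ)).mono' (by fun_prop) (ae_of_all _ fun ω => ?_)
    rw [Complex.norm_exp_ofReal_mul_I]
  have h := congrArg Complex.re (integral_cexp_mul_I_of_hasGaussianLaw hW hmW h0)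
  rw [Complex.ofReal_re] at h
  rw [← h]
  simpa [Complex.exp_ofReal_mul_I_re] using integral_re hi

lemma integral_sin_of_hasGaussianLaw {W : Ω → ℝ} (hW : HasGaussianLaw W P)
    (hmW : Measurable W) (h0 : ∫ ω, W ω ∂P = 0) :
    ∫ ω, sin (W ω) ∂P = 0 := by
  have := hW.isProbabilityMeasure
  have hi : Integrable (fun ω => Complex.exp (W ω * Complex.I)) P := by
    refine (integrable_const (1 : ℝ)).mono' (by fun_prop) (ae_of_all _ fun ω => ?_)
    rw [Complex.norm_exp_ofReal_mul_I]
  have h := congrArg Complex.im (integral_cexp_mul_I_of_hasGaussianLaw hW hmW h0)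
  rw [Complex.ofReal_im] at h
  rw [← h]
  simpa [Complex.exp_ofReal_mul_I_im] using integral_im hi

/-- A centred Gaussian pair of random variables. -/
structure CenteredGaussianPair (P : Measure Ω) (U V : Ω → ℝ) : Prop where
  law : HasGaussianLaw (fun ω => (U ω, V ω)) P
  measurable_left : Measurable U
  measurable_right : Measurable V
  mean_left : ∫ ω, U ω ∂P = 0
  mean_right : ∫ ω, V ω ∂P = 0

variable {U V : Ω → ℝ}

namespace CenteredGaussianPair

lemma symm (h : CenteredGaussianPair P U V) : CenteredGaussianPair P V U where
  law := h.law.map (ContinuousLinearEquiv.prodComm ℝ ℝ ℝ : ℝ × ℝ →L[ℝ] ℝ × ℝ)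
  measurable_left := h.measurable_right
  measurable_right := h.measurable_left
  mean_left := h.mean_right
  mean_right := h.mean_left

lemma memLp_left (h : CenteredGaussianPair P U V) : MemLp U 2 P := h.law.fst.memLp_two

lemma memLp_right (h : CenteredGaussianPair P U V) : MemLp V 2 P := h.law.snd.memLp_two

lemma integral_cos (h : CenteredGaussianPair P U V) (s t : ℝ) :
    ∫ ω, cos (s * U ω + t * V ω) ∂P =
      exp (-(s ^ 2 * variance U P + 2 * (s * t * covariance U V P) + t ^ 2 * variance V P) / 2) := by
  have hP := h.law.isProbabilityMeasure
  have hl : HasGaussianLaw (fun ω => s * U ω + t * V ω) P :=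
    h.law.map (s • ContinuousLinearMap.fst ℝ ℝ ℝ + t • ContinuousLinearMap.snd ℝ ℝ ℝ)
  have hmU := h.measurable_left
  have hmV := h.measurable_right
  rw [integral_cos_of_hasGaussianLaw hl (by fun_prop)]
  · congr 3
    rw [variance_fun_add (h.memLp_left.const_mul s) (h.memLp_right.const_mul t),
      variance_const_mul, variance_const_mul, covariance_const_mul_left,
      covariance_const_mul_right]
    ring
  · rw [integral_add (h.law.fst.integrable.const_mul s) (h.law.snd.integrable.const_mul t),
      integral_const_mul, integral_const_mul, h.mean_left, h.mean_right]
    simp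

lemma integral_sin_mul_sin (h : CenteredGaussianPair P U V) (s t : ℝ) :
    ∫ ω, sin (s * U ω) * sin (t * V ω) ∂P =
      (exp (-(s ^ 2 * variance U P - 2 * (s * t * covariance U V P) + t ^ 2 * variance V P) / 2) -
      exp (-(s ^ 2 * variance U P + 2 * (s * t * covariance U V P) + t ^ 2 * variance V P) / 2))
        / 2 := by
  have hP := h.law.isProbabilityMeasure
  have hmU := h.measurable_left
  have hmV := h.measurable_right
  have hi : ∀ t : ℝ, Integrable (fun ω => cos (s * U ω + t * V ω)) P := by
    intro t
    refine (integrable_const (1 : ℝ)).mono' (by fun_prop) (ae_of_all _ fun ω => ?_)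
    exact abs_cos_le_one _
  have e : ∀ ω, sin (s * U ω) * sin (t * V ω) =
      (cos (s * U ω + (-t) * V ω) - cos (s * U ω + t * V ω)) / 2 := by
    intro ω
    rw [neg_mul, ← sub_eq_add_neg, cos_sub, cos_add]; ring
  simp only [e]
  rw [integral_div, integral_sub (hi _) (hi _), h.integral_cos, h.integral_cos]
  congr 3
  ring_nf

/-- By the arithmetic-geometric mean inequality, the cross term in the exponent consumes at most a
fraction `ρ` of the diagonal part. This is the origin of the factors `1 - ρ` in `orderTerm`. -/
lemma abs_integral_sin_mul_sin_le (h : CenteredGaussianPair P U V) {ρ : ℝ} (hρ : 0 ≤ ρ)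
    (hc : |covariance U V P| ≤ ρ * (√(variance U P) * √(variance V P))) (s t : ℝ) :
    |∫ ω, sin (s * U ω) * sin (t * V ω) ∂P| ≤
      exp (-((1 - ρ) * (s ^ 2 * variance U P + t ^ 2 * variance V P) / 2)) := by
  have ha := sq_sqrt (variance_nonneg U P)
  have hb := sq_sqrt (variance_nonneg V P)
  have ha0 := sqrt_nonneg (variance U P)
  have hb0 := sqrt_nonneg (variance V P)
  set a := √(variance U P)
  set b := √(variance V P)
  set c := covariance U V P
  have hst : |s * t * c| ≤ ρ * (s ^ 2 * a ^ 2 + t ^ 2 * b ^ 2) / 2 := by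
    rw [abs_mul]
    have h1 : |s * t| * |c| ≤ |s * t| * (ρ * (a * b)) := by gcongr
    have h2 : |s * t| * (a * b) ≤ (s ^ 2 * a ^ 2 + t ^ 2 * b ^ 2) / 2 := by
      rw [abs_mul, ← sq_abs s, ← sq_abs t]
      nlinarith [sq_nonneg (|s| * a - |t| * b)]
    nlinarith [mul_le_mul_of_nonneg_left h2 hρ]
  obtain ⟨h1, h2⟩ := abs_le.1 hst
  rw [h.integral_sin_mul_sin, ← ha, ← hb]
  have hA : ∀ x : ℝ, x ≤ -((1 - ρ) * (s ^ 2 * a ^ 2 + t ^ 2 * b ^ 2) / 2) →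
      0 < exp x ∧ exp x ≤ exp (-((1 - ρ) * (s ^ 2 * a ^ 2 + t ^ 2 * b ^ 2) / 2)) :=
    fun x hx => ⟨exp_pos _, exp_le_exp.2 hx⟩
  obtain ⟨p1, q1⟩ := hA (-(s ^ 2 * a ^ 2 - 2 * (s * t * c) + t ^ 2 * b ^ 2) / 2)
    (by linarith)
  obtain ⟨p2, q2⟩ := hA (-(s ^ 2 * a ^ 2 + 2 * (s * t * c) + t ^ 2 * b ^ 2) / 2)
    (by linarith)
  rw [abs_le]
  constructor <;> linarith

/-- Differentiate the formula for `E[sin(sU) sin(tV)]` in `t` at `t = 0`, once under the integral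
and once in closed form. -/
lemma integral_mul_sin (h : CenteredGaussianPair P U V) (s : ℝ) :
    ∫ ω, V ω * sin (s * U ω) ∂P =
      s * covariance U V P * exp (-(s ^ 2 * variance U P) / 2) := by
  have hP := h.law.isProbabilityMeasure
  have hmU := h.measurable_left
  have hmV := h.measurable_right
  have hd1 : HasDerivAt (fun t : ℝ => ∫ ω, sin (s * U ω) * sin (t * V ω) ∂P)
      (∫ ω, sin (s * U ω) * (cos (0 * V ω) * V ω) ∂P) 0 := by
    refine (hasDerivAt_integral_of_dominated_loc_of_deriv_le
      (F := fun (t : ℝ) ω => sin (s * U ω) * sin (t * V ω))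
      (F' := fun (t : ℝ) ω => sin (s * U ω) * (cos (t * V ω) * V ω))
      (bound := fun ω => |V ω|) (s := Set.univ) univ_mem ?_ ?_ ?_ ?_ ?_ ?_).2
    · exact Eventually.of_forall fun t => Measurable.aestronglyMeasurable (by fun_prop)
    · simp
    · exact Measurable.aestronglyMeasurable (by fun_prop)
    · refine ae_of_all _ fun ω t _ => ?_
      rw [norm_mul, norm_mul, norm_eq_abs, norm_eq_abs, norm_eq_abs]
      have h1 := abs_sin_le_one (s * U ω)
      have h2 := abs_cos_le_one (t * V ω)
      calc _ ≤ 1 * (1 * |V ω|) := by gcongr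
        _ = _ := by ring
    · exact h.law.snd.integrable.abs
    · refine ae_of_all _ fun ω t _ => ?_
      have := ((hasDerivAt_id t).mul_const (V ω)).sin.const_mul (sin (s * U ω))
      simpa using this
  have hd2 : HasDerivAt (fun t : ℝ => ∫ ω, sin (s * U ω) * sin (t * V ω) ∂P)
      (s * covariance U V P * exp (-(s ^ 2 * variance U P) / 2)) 0 := by
    simp only [h.integral_sin_mul_sin]
    -- The signs `σ = -1` and `σ = 1` give the two exponentials of the closed form.
    have hq : ∀ σ : ℝ, HasDerivAt (fun t : ℝ => exp (-(s ^ 2 * variance U P +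
        σ * (2 * (s * t * covariance U V P)) + t ^ 2 * variance V P) / 2))
        (exp (-(s ^ 2 * variance U P) / 2) * (-(σ * (s * covariance U V P)))) 0 := by
      intro σ
      have h1 : HasDerivAt (fun t : ℝ => -(s ^ 2 * variance U P +
          σ * (2 * (s * t * covariance U V P)) + t ^ 2 * variance V P) / 2)
          (-(σ * (s * covariance U V P))) 0 := by
        have hid := hasDerivAt_id (0 : ℝ)
        have := ((((((hid.const_mul s).mul_const (covariance U V P)).const_mul 2).const_mul
          σ).const_add (s ^ 2 * variance U P)).add ((hid.pow 2).mul_const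
          (variance V P))).neg.div_const 2
        convert! this using 1
        simp
        ring
      have := h1.exp
      convert! this using 2
      simp
    have := ((hq (-1)).sub (hq 1)).div_const 2
    convert! this using 1
    · funext t
      simp only [Pi.sub_apply]
      ring_nf
    · ring
  have := hd1.unique hd2
  rw [← this]
  refine integral_congr_ae (ae_of_all _ fun ω => ?_)
  simp [mul_comm]

/-- Rounding ties form a countable set, which is null for a nondegenerate Gaussian law. -/
lemma ae_abs_div_sub_round_lt (h : CenteredGaussianPair P U V) {Δ : ℝ} (hΔ : 0 < Δ)
    (hv : 0 < variance U P) : ∀ᵐ ω ∂P, |U ω / Δ - round (U ω / Δ)| < 1 / 2 := by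
  have hmap := h.law.fst.map_eq_gaussianReal
  have hne : (variance U P).toNNReal ≠ 0 := (Real.toNNReal_pos.2 hv).ne'
  have hS : (Set.range fun j : ℤ => Δ * ((j : ℝ) + 1 / 2)).Countable := Set.countable_range _
  have h0 : P.map U (Set.range fun j : ℤ => Δ * ((j : ℝ) + 1 / 2)) = 0 := by
    rw [hmap]
    have := nullSingletonClass_gaussianReal (μ := ∫ ω, U ω ∂P) hne
    exact hS.measure_zero _
  rw [Measure.map_apply h.measurable_left hS.measurableSet] at h0
  filter_upwards [measure_eq_zero_iff_ae_notMem.1 h0] with ω hω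
  refine lt_of_le_of_ne (abs_sub_round _) fun heq => hω ?_
  rcases abs_eq (by norm_num : (0 : ℝ) ≤ 1 / 2) |>.1 heq with h1 | h1
  · exact ⟨round (U ω / Δ), by
      rw [sub_eq_iff_eq_add, div_eq_iff hΔ.ne'] at h1; simp only; linarith⟩
  · refine ⟨round (U ω / Δ) - 1, ?_⟩
    rw [sub_eq_iff_eq_add, div_eq_iff hΔ.ne'] at h1
    push_cast
    linarith

end CenteredGaussianPair

end Moments

/-! ### Summation of Gaussian exponentials over the harmonics. -/

section Series

/-- The constant `1 / (1 - e^{-θ})²` dominating the Gaussian sums of ratio `e^{-θ}`. -/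
noncomputable def gaussSumConst (θ : ℝ) : ℝ := 1 / (1 - exp (-θ)) ^ 2

/-- A summable majorant of the sequence `exp (-θ w n²)`. -/
noncomputable def gaussMajorant (θ w : ℝ) (n : ℕ) : ℝ :=
  exp (-(θ * w)) * (exp θ * (n * exp (-θ) ^ n))

lemma gaussMajorant_zero (θ w : ℝ) : gaussMajorant θ w 0 = 0 := by simp [gaussMajorant]

lemma hasSum_gaussMajorant {θ : ℝ} (hθ : 0 < θ) (w : ℝ) :
    HasSum (gaussMajorant θ w) (exp (-(θ * w)) * gaussSumConst θ) := by
  have h1 : ‖exp (-θ)‖ < 1 := by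
    rw [norm_eq_abs, abs_exp]; exact Real.exp_lt_one_iff.2 (by linarith)
  have h := ((hasSum_coe_mul_geometric_of_norm_lt_one h1).mul_left (exp θ)).mul_left
    (exp (-(θ * w)))
  convert! h using 1
  rw [gaussSumConst, ← mul_div_assoc (exp θ), ← exp_add θ, add_neg_cancel, exp_zero]

/-- Uses `w n² ≥ w + n - 1` for `w, n ≥ 1`, which extracts the decay of the first harmonic and
leaves a geometric tail. -/
lemma exp_le_gaussMajorant {θ w : ℝ} (hθ : 0 < θ) (hw : 1 ≤ w) {n : ℕ} (hn : 1 ≤ n) :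
    exp (-(θ * w * n ^ 2)) ≤ gaussMajorant θ w n := by
  have hn' : (1 : ℝ) ≤ n := by exact_mod_cast hn
  have h1 : exp (-(θ * w * n ^ 2)) ≤ exp (-(θ * w)) * (exp θ * exp (-θ) ^ n) := by
    rw [← exp_nat_mul, ← exp_add, ← exp_add, exp_le_exp]
    nlinarith [mul_nonneg hθ.le (mul_nonneg (sub_nonneg.2 hw) (by nlinarith : 0 ≤ (n : ℝ) ^ 2 - 1)),
      mul_nonneg hθ.le (mul_nonneg (by linarith : 0 ≤ (n : ℝ)) (sub_nonneg.2 hn'))]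
  refine h1.trans ?_
  unfold gaussMajorant
  have : exp (-θ) ^ n ≤ n * exp (-θ) ^ n := le_mul_of_one_le_left (by positivity) hn'
  gcongr

lemma gaussSumConst_nonneg (θ : ℝ) : 0 ≤ gaussSumConst θ := by unfold gaussSumConst; positivity

lemma gaussSumConst_two_pi_sq_le : gaussSumConst (2 * π ^ 2) ≤ 2 := by
  have h : exp (-(2 * π ^ 2)) ≤ 1 / 4 := by
    rw [exp_neg, ← one_div]
    refine one_div_le_one_div_of_le (by norm_num) ?_
    have := add_one_le_exp (2 * π ^ 2)
    nlinarith [pi_gt_three]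
  unfold gaussSumConst
  rw [div_le_iff₀ (by nlinarith)]
  nlinarith

end Series

/-! ### Effect of quantization on the covariances of a Gaussian pair. -/

namespace CenteredGaussianPair

variable {U V : Ω → ℝ}

/-- The factor `n` from `integral_mul_sin` cancels the Fourier coefficient `1/(πn)`, leaving `2/Δ`
for each harmonic. The constant `4` is this `2` times the bound `2` on `gaussSumConst (2π²)`. -/
lemma abs_integral_mul_sawtooth_le (h : CenteredGaussianPair P U V) {Δ : ℝ} (hΔ : 0 < Δ)
    (hv : Δ ^ 2 ≤ variance U P) :
    |∫ ω, V ω * (Δ * sawtooth (U ω / Δ)) ∂P| ≤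
      4 * |covariance U V P| * exp (-(2 * π ^ 2 * (variance U P / Δ ^ 2))) := by
  have hw : 1 ≤ variance U P / Δ ^ 2 := (one_le_div (by positivity)).2 hv
  have hpi : 0 < 2 * π ^ 2 := by positivity
  have hsum := (hasSum_gaussMajorant hpi (variance U P / Δ ^ 2)).mul_left
    (2 * |covariance U V P| / Δ)
  have hmU := h.measurable_left
  have key := GrangerQuantized.abs_integral_mul_sawtooth_le h.law.snd.integrable
    (u := fun ω => U ω / Δ) (by fun_prop)
    (h.ae_abs_div_sub_round_lt hΔ (lt_of_lt_of_le (by positivity) hv)) hsum.summable ?_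
  · rw [hsum.tsum_eq] at key
    have e : ∫ ω, V ω * (Δ * sawtooth (U ω / Δ)) ∂P
        = Δ * ∫ ω, V ω * sawtooth (U ω / Δ) ∂P := by
      rw [← integral_const_mul]
      exact integral_congr_ae (ae_of_all _ fun ω => by ring)
    rw [e, abs_mul, abs_of_pos hΔ]
    refine (mul_le_mul_of_nonneg_left key hΔ.le).trans ?_
    have h2 := mul_le_mul_of_nonneg_left gaussSumConst_two_pi_sq_le
      (by positivity : 0 ≤ 2 * |covariance U V P| *
        exp (-(2 * π ^ 2 * (variance U P / Δ ^ 2))))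
    calc _ = 2 * |covariance U V P| * exp (-(2 * π ^ 2 * (variance U P / Δ ^ 2))) *
          gaussSumConst (2 * π ^ 2) := by field_simp
      _ ≤ _ := by linarith
  · intro n
    rcases Nat.eq_zero_or_pos n with rfl | hn
    · simp [gaussMajorant_zero]
    · have hn0 : (0 : ℝ) < n := by exact_mod_cast hn
      have e : ∀ ω, sin (2 * π * n * (U ω / Δ)) = sin (2 * π * n / Δ * U ω) := by
        intro ω; congr 1; ring
      simp only [e]
      rw [h.integral_mul_sin, abs_mul, abs_mul, abs_exp, abs_of_pos (by positivity)]
      have h1 := exp_le_gaussMajorant hpi hw hn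
      calc _ = 2 * |covariance U V P| / Δ *
            exp (-(2 * π ^ 2 * (variance U P / Δ ^ 2) * n ^ 2)) := by
            rw [show -((2 * π * n / Δ) ^ 2 * variance U P) / 2
              = -(2 * π ^ 2 * (variance U P / Δ ^ 2) * n ^ 2) by field_simp]
            field_simp
        _ ≤ _ := by gcongr

lemma abs_integral_sawtooth_mul_sawtooth_le (h : CenteredGaussianPair P U V) {Δ Δ' : ℝ}
    (hΔ : 0 < Δ) (hΔ' : 0 < Δ') (hv : Δ ^ 2 ≤ variance U P) (hv' : Δ' ^ 2 ≤ variance V P)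
    {ρ : ℝ} (hρ : 0 ≤ ρ) (hρ1 : ρ < 1)
    (hc : |covariance U V P| ≤ ρ * (√(variance U P) * √(variance V P))) :
    |∫ ω, (Δ * sawtooth (U ω / Δ)) * (Δ' * sawtooth (V ω / Δ')) ∂P| ≤
      Δ * Δ' * (gaussSumConst (2 * π ^ 2 * (1 - ρ)) ^ 2 *
        exp (-(2 * π ^ 2 * (1 - ρ) * (variance U P / Δ ^ 2 + variance V P / Δ' ^ 2)))) := by
  have hP := h.law.isProbabilityMeasure
  have hw : 1 ≤ variance U P / Δ ^ 2 := (one_le_div (by positivity)).2 hv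
  have hw' : 1 ≤ variance V P / Δ' ^ 2 := (one_le_div (by positivity)).2 hv'
  have hθ : 0 < 2 * π ^ 2 * (1 - ρ) := by
    have := sub_pos.2 hρ1
    positivity
  set θ := 2 * π ^ 2 * (1 - ρ) with hθdef
  set w := variance U P / Δ ^ 2 with hwdef
  set w' := variance V P / Δ' ^ 2 with hwdef'
  have hmU := h.measurable_left
  have hmV := h.measurable_right
  have hs := hasSum_gaussMajorant hθ w
  have hs' := hasSum_gaussMajorant hθ w'
  have hsd : ∀ n : ℕ, 1 ≤ n → ∀ x : ℝ, 0 ≤ x → x / (π * n) ≤ x := by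
    intro n hn x hx
    have : (1 : ℝ) ≤ n := by exact_mod_cast hn
    refine div_le_self hx ?_
    nlinarith [pi_gt_three]
  -- The double series is summed in two stages: the sawtooth of `V` is expanded against a fixed
  -- harmonic of `U`, then the sawtooth of `U` against the sawtooth of `V`.
  have h1 : ∀ n : ℕ, |∫ ω, sin (2 * π * n * (U ω / Δ)) * sawtooth (V ω / Δ') ∂P| ≤
      exp (-(θ * w * n ^ 2)) * (exp (-(θ * w')) * gaussSumConst θ) := by
    intro n
    have hsum := hs'.mul_left (exp (-(θ * w * n ^ 2)))
    rw [← hsum.tsum_eq]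
    refine GrangerQuantized.abs_integral_mul_sawtooth_le ?_ (by fun_prop)
      (h.symm.ae_abs_div_sub_round_lt hΔ' (lt_of_lt_of_le (by positivity) hv')) hsum.summable ?_
    · exact (integrable_const (1 : ℝ)).mono' (by fun_prop)
        (ae_of_all _ fun ω => abs_sin_le_one _)
    · intro p
      rcases Nat.eq_zero_or_pos p with rfl | hp
      · simp [gaussMajorant_zero]
      · refine (hsd p hp _ (abs_nonneg _)).trans ?_
        have e : ∀ ω, sin (2 * π * n * (U ω / Δ)) * sin (2 * π * p * (V ω / Δ')) =
            sin (2 * π * n / Δ * U ω) * sin (2 * π * p / Δ' * V ω) := by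
          intro ω; congr 2 <;> ring
        simp only [e]
        refine (h.abs_integral_sin_mul_sin_le hρ hc _ _).trans ?_
        calc _ = exp (-(θ * w * n ^ 2)) * exp (-(θ * w' * p ^ 2)) := by
              rw [← exp_add, hθdef, hwdef, hwdef']
              congr 1
              field_simp
              ring
          _ ≤ _ := by
              have := exp_le_gaussMajorant hθ hw' hp
              gcongr
  have hsum := hs.mul_right (exp (-(θ * w')) * gaussSumConst θ)
  have key := GrangerQuantized.abs_integral_mul_sawtooth_le (P := P)
    (g := fun ω => sawtooth (V ω / Δ')) (u := fun ω => U ω / Δ) ?_ (by fun_prop)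
    (h.ae_abs_div_sub_round_lt hΔ (lt_of_lt_of_le (by positivity) hv)) hsum.summable ?_
  · rw [hsum.tsum_eq] at key
    have e : ∫ ω, (Δ * sawtooth (U ω / Δ)) * (Δ' * sawtooth (V ω / Δ')) ∂P
        = Δ * Δ' * ∫ ω, sawtooth (V ω / Δ') * sawtooth (U ω / Δ) ∂P := by
      rw [← integral_const_mul]
      exact integral_congr_ae (ae_of_all _ fun ω => by ring)
    rw [e, abs_mul, abs_of_pos (mul_pos hΔ hΔ')]
    refine (mul_le_mul_of_nonneg_left key (by positivity)).trans (le_of_eq ?_)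
    rw [mul_add θ, neg_add, exp_add]
    ring
  · exact (integrable_const (1 / 2 : ℝ)).mono'
      (measurable_sawtooth.comp (by fun_prop)).aestronglyMeasurable
      (ae_of_all _ fun ω => abs_sawtooth_le _)
  · intro n
    rcases Nat.eq_zero_or_pos n with rfl | hn
    · simp [gaussMajorant_zero]
    · refine (hsd n hn _ (abs_nonneg _)).trans ?_
      simp only [mul_comm (sawtooth _)]
      refine (h1 n).trans ?_
      have := exp_le_gaussMajorant hθ hw hn
      have := gaussSumConst_nonneg θ
      gcongr

/-- The rounding error is nearly uniform on an interval of length `Δ`, whose variance is `Δ²/12`. -/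
lemma abs_integral_sawtooth_sq_sub_le (h : CenteredGaussianPair P U V) {Δ : ℝ}
    (hΔ : 0 < Δ) (hv : Δ ^ 2 ≤ variance U P) :
    |∫ ω, (Δ * sawtooth (U ω / Δ)) * (Δ * sawtooth (U ω / Δ)) ∂P - Δ ^ 2 / 12| ≤
      2 * Δ ^ 2 * exp (-(2 * π ^ 2 * (variance U P / Δ ^ 2))) := by
  have hP := h.law.isProbabilityMeasure
  have hw : 1 ≤ variance U P / Δ ^ 2 := (one_le_div (by positivity)).2 hv
  have hpi : 0 < 2 * π ^ 2 := by positivity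
  have hsum := hasSum_gaussMajorant hpi (variance U P / Δ ^ 2)
  have hmU := h.measurable_left
  have key := GrangerQuantized.abs_integral_sawtooth_sq_sub_le (P := P)
    (u := fun ω => U ω / Δ) (by fun_prop) hsum.summable ?_
  · rw [hsum.tsum_eq] at key
    have e : ∫ ω, (Δ * sawtooth (U ω / Δ)) * (Δ * sawtooth (U ω / Δ)) ∂P - Δ ^ 2 / 12
        = Δ ^ 2 * (∫ ω, sawtooth (U ω / Δ) ^ 2 ∂P - 1 / 12) := by
      rw [mul_sub, ← integral_const_mul, mul_one_div]
      congr 1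
      exact integral_congr_ae (ae_of_all _ fun ω => by ring)
    rw [e, abs_mul, abs_of_pos (by positivity)]
    have h2 := mul_le_mul_of_nonneg_left gaussSumConst_two_pi_sq_le
      (exp_pos (-(2 * π ^ 2 * (variance U P / Δ ^ 2)))).le
    calc _ ≤ Δ ^ 2 * (exp (-(2 * π ^ 2 * (variance U P / Δ ^ 2))) * 2) := by
          gcongr; exact key.trans h2
      _ = _ := by ring
  · intro n
    rcases Nat.eq_zero_or_pos n with rfl | hn
    · simp [gaussMajorant_zero]
    · have hn1 : (1 : ℝ) ≤ n := by exact_mod_cast hn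
      have e : ∀ ω, cos (2 * π * n * (U ω / Δ)) = cos (2 * π * n / Δ * U ω + 0 * V ω) := by
        intro ω; congr 1; ring
      simp only [e]
      rw [h.integral_cos, abs_exp]
      refine (div_le_self (exp_pos _).le ?_).trans ((le_of_eq ?_).trans
        (exp_le_gaussMajorant hpi hw hn))
      · exact one_le_pow₀ (by nlinarith [pi_gt_three])
      · congr 1; field_simp; ring

/-- Every harmonic is odd and so has mean zero; the majorant can be taken to be `0`. -/
lemma integral_sawtooth (h : CenteredGaussianPair P U V) {Δ : ℝ}
    (hΔ : 0 < Δ) (hv : 0 < variance U P) :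
    ∫ ω, Δ * sawtooth (U ω / Δ) ∂P = 0 := by
  have hP := h.law.isProbabilityMeasure
  have hmU := h.measurable_left
  have key := GrangerQuantized.abs_integral_mul_sawtooth_le (P := P) (g := fun _ => 1)
    (integrable_const (1 : ℝ)) (u := fun ω => U ω / Δ) (by fun_prop)
    (h.ae_abs_div_sub_round_lt hΔ hv) (B := fun _ => 0) summable_zero ?_
  · rw [integral_const_mul]
    simp only [one_mul, tsum_zero, abs_nonpos_iff] at key
    rw [key, mul_zero]
  · intro n
    have hl : HasGaussianLaw (fun ω => 2 * π * n / Δ * U ω) P :=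
      h.law.fst.map ((2 * π * n / Δ) • ContinuousLinearMap.id ℝ ℝ)
    have h0 := integral_sin_of_hasGaussianLaw hl (by fun_prop)
      (by rw [integral_const_mul, h.mean_left, mul_zero])
    have e : ∀ ω, (1 : ℝ) * sin (2 * π * n * (U ω / Δ)) = sin (2 * π * n / Δ * U ω) := by
      intro ω; rw [one_mul]; congr 1; ring
    simp only [e, h0, abs_zero, zero_div, le_refl]

lemma memLp_sawtooth [IsFiniteMeasure P] (hU : Measurable U) (Δ : ℝ) :
    MemLp (fun ω => Δ * sawtooth (U ω / Δ)) 2 P :=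
  (MemLp.of_bound (measurable_sawtooth.comp (by fun_prop)).aestronglyMeasurable (1 / 2)
    (ae_of_all _ fun ω => abs_sawtooth_le _)).const_mul Δ

lemma quantize_eq_add_sawtooth {Δ : ℝ} (hΔ : 0 < Δ) (w : ℝ) :
    quantize Δ w = w + Δ * sawtooth (w / Δ) := by
  rw [quantize, sawtooth]; field_simp; ring

lemma covariance_quantize (h : CenteredGaussianPair P U V) {Δ Δ' : ℝ}
    (hΔ : 0 < Δ) (hΔ' : 0 < Δ') (hv : 0 < variance U P) (hv' : 0 < variance V P) :
    covariance (fun ω => quantize Δ (U ω)) (fun ω => quantize Δ' (V ω)) P =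
      covariance U V P + ∫ ω, U ω * (Δ' * sawtooth (V ω / Δ')) ∂P +
        ∫ ω, V ω * (Δ * sawtooth (U ω / Δ)) ∂P +
        ∫ ω, (Δ * sawtooth (U ω / Δ)) * (Δ' * sawtooth (V ω / Δ')) ∂P := by
  have hP := h.law.isProbabilityMeasure
  have hN := memLp_sawtooth (P := P) h.measurable_left Δ
  have hN' := memLp_sawtooth (P := P) h.measurable_right Δ'
  have e1 : (fun ω => quantize Δ (U ω)) = U + fun ω => Δ * sawtooth (U ω / Δ) :=
    funext fun ω => quantize_eq_add_sawtooth hΔ _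
  have e2 : (fun ω => quantize Δ' (V ω)) = V + fun ω => Δ' * sawtooth (V ω / Δ') :=
    funext fun ω => quantize_eq_add_sawtooth hΔ' _
  rw [e1, e2, covariance_add_left h.memLp_left hN (h.memLp_right.add hN'),
    covariance_add_right h.memLp_left h.memLp_right hN',
    covariance_add_right hN h.memLp_right hN', covariance_eq_sub h.memLp_left hN',
    covariance_eq_sub hN h.memLp_right, covariance_eq_sub hN hN',
    h.integral_sawtooth hΔ hv, h.symm.integral_sawtooth hΔ' hv']
  simp only [Pi.mul_apply, mul_zero, zero_mul, sub_zero]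
  simp only [mul_comm _ (V _)]
  ring

lemma abs_covariance_quantize_sub_le (h : CenteredGaussianPair P U V) {Δ Δ' : ℝ}
    (hΔ : 0 < Δ) (hΔ' : 0 < Δ') (hv : Δ ^ 2 ≤ variance U P) (hv' : Δ' ^ 2 ≤ variance V P)
    {ρ : ℝ} (hρ : 0 ≤ ρ) (hρ1 : ρ < 1)
    (hc : |covariance U V P| ≤ ρ * (√(variance U P) * √(variance V P))) :
    |covariance (fun ω => quantize Δ (U ω)) (fun ω => quantize Δ' (V ω)) P -
        covariance U V P| ≤
      4 * |covariance U V P| * exp (-(2 * π ^ 2 * (variance U P / Δ ^ 2))) +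
      4 * |covariance U V P| * exp (-(2 * π ^ 2 * (variance V P / Δ' ^ 2))) +
      Δ * Δ' * (gaussSumConst (2 * π ^ 2 * (1 - ρ)) ^ 2 *
        exp (-(2 * π ^ 2 * (1 - ρ) * (variance U P / Δ ^ 2 + variance V P / Δ' ^ 2)))) := by
  have h1 := h.abs_integral_mul_sawtooth_le hΔ hv
  have h2 := h.symm.abs_integral_mul_sawtooth_le hΔ' hv'
  have h3 := h.abs_integral_sawtooth_mul_sawtooth_le hΔ hΔ' hv hv' hρ hρ1 hc
  rw [covariance_comm V U] at h2
  rw [h.covariance_quantize hΔ hΔ' (lt_of_lt_of_le (by positivity) hv)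
    (lt_of_lt_of_le (by positivity) hv')]
  rw [abs_le] at *
  constructor <;> linarith [h1.1, h1.2, h2.1, h2.2, h3.1, h3.2]

/-- At correlation `1` the bound with `1 - ρ` is void, so the squared sawtooth is used instead. The
constant is `10 = 4 + 4 + 2`, after replacing `Δ²` by the variance. -/
lemma abs_variance_quantize_sub_le (h : CenteredGaussianPair P U U) {Δ : ℝ}
    (hΔ : 0 < Δ) (hv : Δ ^ 2 ≤ variance U P) :
    |covariance (fun ω => quantize Δ (U ω)) (fun ω => quantize Δ (U ω)) P -
        covariance U U P - Δ ^ 2 / 12| ≤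
      10 * variance U P * exp (-(2 * π ^ 2 * (variance U P / Δ ^ 2))) := by
  have h1 := h.abs_integral_mul_sawtooth_le hΔ hv
  have h3 := h.abs_integral_sawtooth_sq_sub_le hΔ hv
  have hv0 : 0 < variance U P := lt_of_lt_of_le (by positivity) hv
  have hself : covariance U U P = variance U P := covariance_self h.measurable_left.aemeasurable
  rw [h.covariance_quantize hΔ hΔ hv0 hv0]
  rw [hself, abs_of_pos hv0] at h1
  have h4 := mul_le_mul_of_nonneg_right hv
    (exp_pos (-(2 * π ^ 2 * (variance U P / Δ ^ 2)))).le
  rw [abs_le] at *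
  constructor <;> linarith [h1.1, h1.2, h3.1, h3.2]

end CenteredGaussianPair

end GrangerQuantized

namespace GrangerQuantized

/-! ### Smallest singular value and distance from a rank-deficient matrix. -/

section SingularValue

open Module

variable {ι κ : Type*} [Fintype ι] [Fintype κ] [DecidableEq κ]

/-- On the span of the first right singular vectors, the operator expands by at least the
corresponding singular value. -/
lemma exists_singularValue_lower_bound {E F G : Type*}
    [NormedAddCommGroup E] [InnerProductSpace ℝ E] [FiniteDimensional ℝ E]
    [NormedAddCommGroup F] [InnerProductSpace ℝ F] [FiniteDimensional ℝ F]
    [AddCommGroup G] [Module ℝ G] [FiniteDimensional ℝ G]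
    (T : E →ₗ[ℝ] F) (S : E →ₗ[ℝ] G) {r : ℕ} (hr : r < finrank ℝ E)
    (hS : finrank ℝ S.range ≤ r) :
    ∃ u : E, ‖u‖ = 1 ∧ S u = 0 ∧ T.singularValues r ≤ ‖T u‖ := by
  let b := T.isSymmetric_adjoint_comp_self.eigenvectorBasis rfl
  let e : Fin (r + 1) → Fin (finrank ℝ E) := Fin.castLE hr
  have horth : Orthonormal ℝ (b ∘ e) := b.orthonormal.comp e (Fin.castLE_injective _)
  let L : (Fin (r + 1) → ℝ) →ₗ[ℝ] E := Fintype.linearCombination ℝ (b ∘ e)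
  -- The first `r + 1` right singular vectors span a space too large for `S`, of rank at most `r`,
  -- to be injective on it.
  have hker : (S.rangeRestrict ∘ₗ L).ker ≠ ⊥ := by
    refine LinearMap.ker_ne_bot_of_finrank_lt ?_
    rw [finrank_fin_fun]
    omega
  obtain ⟨c, hc, hc0⟩ := Submodule.exists_mem_ne_zero_of_ne_bot hker
  have hSc : S (L c) = 0 := by
    have := LinearMap.mem_ker.1 hc
    simpa using congrArg Subtype.val this
  have hLc : L c = ∑ i, c i • (b ∘ e) i := rfl
  have hn : ‖L c‖ ^ 2 = ∑ i, c i ^ 2 := by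
    rw [← real_inner_self_eq_norm_sq, hLc, horth.inner_sum]
    simp [sq]
  have hT : ‖T (L c)‖ ^ 2 = ∑ i : Fin (r + 1), T.singularValues i ^ 2 * c i ^ 2 := by
    have h1 : (LinearMap.adjoint T ∘ₗ T) (L c) =
        ∑ i : Fin (r + 1), (T.singularValues i ^ 2 * c i) • (b ∘ e) i := by
      rw [hLc, map_sum]
      refine Finset.sum_congr rfl fun i _ => ?_
      rw [map_smul, Function.comp_apply, LinearMap.IsSymmetric.apply_eigenvectorBasis,
        ← T.sq_singularValues_fin, smul_smul]
      simp [b, e, mul_comm]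
    rw [← real_inner_self_eq_norm_sq, ← LinearMap.adjoint_inner_left, ← LinearMap.comp_apply, h1,
      hLc, horth.inner_sum]
    refine Finset.sum_congr rfl fun i _ => ?_
    simp
    ring
  have hle : T.singularValues r ^ 2 * ‖L c‖ ^ 2 ≤ ‖T (L c)‖ ^ 2 := by
    rw [hn, hT, Finset.mul_sum]
    refine Finset.sum_le_sum fun i _ => ?_
    have := T.singularValues_antitone (show (i : ℕ) ≤ r by omega)
    have := T.singularValues_nonneg r
    gcongr
  have hpos : 0 < ‖L c‖ := by
    refine norm_pos_iff.2 fun h0 => hc0 ?_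
    have : Function.Injective L :=
      horth.linearIndependent.fintypeLinearCombination_injective
    exact this (h0.trans (map_zero L).symm)
  refine ⟨‖L c‖⁻¹ • L c, ?_, ?_, ?_⟩
  · rw [norm_smul, norm_inv, norm_norm, inv_mul_cancel₀ hpos.ne']
  · rw [map_smul, hSc, smul_zero]
  · rw [map_smul, norm_smul, norm_inv, norm_norm, ← div_eq_inv_mul, le_div_iff₀ hpos]
    rw [← mul_pow] at hle
    exact (pow_le_pow_iff_left₀ (mul_nonneg (T.singularValues_nonneg r) hpos.le)
      (norm_nonneg _) two_ne_zero).1 hle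

/-- A left null vector makes `C` non-surjective, so its rank is at most `card ι - 1`, the index of
the last singular value of `A`. On `ker C`, `A` and `A - C` agree. -/
lemma exists_sigmaMin_le_norm (A C : Matrix ι κ ℝ) [Nonempty ι]
    (hcard : Fintype.card ι ≤ Fintype.card κ)
    {v : ι → ℝ} (hv : v ≠ 0) (hvC : Matrix.vecMul v C = 0) :
    ∃ u : EuclideanSpace ℝ κ, ‖u‖ = 1 ∧
      sigmaMin A ≤ ‖Matrix.toEuclideanLin (A - C) u‖ := by
  have hpos : 0 < Fintype.card ι := Fintype.card_pos
  obtain ⟨u, hu1, hu2, hu3⟩ := exists_singularValue_lower_bound (Matrix.toEuclideanLin A)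
    (Matrix.toEuclideanLin C) (r := Fintype.card ι - 1) (by rw [finrank_euclideanSpace]; omega) (by
      -- If `C y = v`, then `v ⬝ v = (v C) ⬝ y = 0`.
      have hne : (Matrix.toEuclideanLin C).range ≠ ⊤ := by
        intro htop
        obtain ⟨y, hy⟩ := LinearMap.range_eq_top.1 htop (WithLp.toLp 2 v)
        have hy' : C.mulVec (WithLp.ofLp y) = v := by
          rw [Matrix.toLpLin_apply] at hy
          exact congrArg WithLp.ofLp hy
        have h1 : v ⬝ᵥ v = 0 := by
          nth_rw 2 [← hy']
          rw [Matrix.dotProduct_mulVec, hvC, zero_dotProduct]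
        exact hv (dotProduct_self_eq_zero.1 h1)
      have := Submodule.finrank_lt hne
      rw [finrank_euclideanSpace] at this
      omega)
  refine ⟨u, hu1, ?_⟩
  rw [map_sub, LinearMap.sub_apply, hu2, sub_zero, sigmaMin, min_eq_left hcard]
  exact hu3

end SingularValue

/-! ### Norm of the block error matrix. -/

section NormBounds

variable {ι κ : Type*} [Fintype ι] [Fintype κ]

/-- The Frobenius bound: Cauchy-Schwarz in each row. -/
lemma norm_sum_mul_le {M : ι → κ → ℝ} {u : κ → ℝ} {a N : ℝ} (ha : 0 ≤ a) (hN : 0 ≤ N)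
    (hM : ∀ i j, |M i j| ≤ a) (hu : ∑ j, u j ^ 2 ≤ 1)
    (hcard : (Fintype.card ι : ℝ) * Fintype.card κ ≤ N ^ 2) :
    ‖(WithLp.toLp 2 (fun i => ∑ j, M i j * u j) : EuclideanSpace ℝ ι)‖ ≤ N * a := by
  rw [EuclideanSpace.norm_eq, Real.sqrt_le_left (by positivity)]
  calc _ ≤ ∑ _i : ι, (Fintype.card κ * a ^ 2 : ℝ) := by
        refine Finset.sum_le_sum fun i _ => ?_
        rw [Real.norm_eq_abs, sq_abs]
        refine (Finset.sum_mul_sq_le_sq_mul_sq _ _ _).trans ?_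
        have h1 : ∑ j, M i j ^ 2 ≤ Fintype.card κ * a ^ 2 := by
          calc _ ≤ ∑ _j : κ, a ^ 2 := Finset.sum_le_sum fun j _ => by
                rw [← sq_abs]; exact pow_le_pow_left₀ (abs_nonneg _) (hM i j) 2
            _ = _ := by simp
        calc _ ≤ (Fintype.card κ * a ^ 2 : ℝ) * 1 :=
              mul_le_mul h1 hu (Finset.sum_nonneg fun _ _ => sq_nonneg _) (by positivity)
          _ = _ := mul_one _
    _ = (Fintype.card ι : ℝ) * Fintype.card κ * a ^ 2 := by simp; ring
    _ ≤ N ^ 2 * a ^ 2 := by gcongr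
    _ = _ := by ring

/-- Norm of a matrix made of a small block, a block close to a multiple of `[I; 0]`, and
another small block. -/
lemma norm_blockMatrix_apply_le {m l : ℕ}
    (E : Matrix (Fin (m + 1)) (Fin m ⊕ Fin m ⊕ Fin l) ℝ) {a b D : ℝ}
    (ha : 0 ≤ a) (hb : 0 ≤ b) (hD : 0 ≤ D)
    (hx : ∀ i j, |E i (Sum.inl j)| ≤ a)
    (hz : ∀ i j, |E i (Sum.inr (Sum.inl j)) - if i = j.castSucc then D else 0| ≤ b)
    (ho : ∀ i j, |E i (Sum.inr (Sum.inr j))| ≤ b)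
    (u : EuclideanSpace ℝ (Fin m ⊕ Fin m ⊕ Fin l)) (hu : ‖u‖ = 1) :
    ‖Matrix.toEuclideanLin E u‖ ≤ (m + 1) * a + D + (2 * m + 1 + l) * b := by
  have hsq : ∑ j, u (Sum.inl j) ^ 2 +
      (∑ j, u (Sum.inr (Sum.inl j)) ^ 2 + ∑ j, u (Sum.inr (Sum.inr j)) ^ 2) = 1 := by
    have := EuclideanSpace.norm_sq_eq u
    rw [hu] at this
    simpa [Fintype.sum_sum_type] using this.symm
  have n1 : 0 ≤ ∑ j, u (Sum.inl j) ^ 2 := Finset.sum_nonneg fun _ _ => sq_nonneg _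
  have n2 : 0 ≤ ∑ j, u (Sum.inr (Sum.inl j)) ^ 2 := Finset.sum_nonneg fun _ _ => sq_nonneg _
  have n3 : 0 ≤ ∑ j, u (Sum.inr (Sum.inr j)) ^ 2 := Finset.sum_nonneg fun _ _ => sq_nonneg _
  have h1 := norm_sum_mul_le (M := fun i j => E i (Sum.inl j)) (u := fun j => u (Sum.inl j))
    (N := m + 1) ha (by positivity) hx (by linarith) (by simp; nlinarith [(m.cast_nonneg : (0:ℝ) ≤ m)])
  let M3 : Fin (m + 1) → Fin m ⊕ Fin l → ℝ := fun i => Sum.elim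
    (fun j => E i (Sum.inr (Sum.inl j)) - if i = j.castSucc then D else 0)
    (fun j => E i (Sum.inr (Sum.inr j)))
  -- The remainder has `m + 1` rows and `m + l` columns; the sum of the two numbers serves as `N`.
  have h3 := norm_sum_mul_le (M := M3) (u := fun j => u (Sum.inr j))
    (N := 2 * m + 1 + l) hb (by positivity)
    (by rintro i (j | j); exacts [hz i j, ho i j])
    (by simp only [Fintype.sum_sum_type]; linarith)
    (by simp; nlinarith [(m.cast_nonneg : (0:ℝ) ≤ m), (l.cast_nonneg : (0:ℝ) ≤ l),
      mul_nonneg (m.cast_nonneg : (0:ℝ) ≤ m) (l.cast_nonneg : (0:ℝ) ≤ l)])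
  -- `D [I; 0]` is `D` times an isometry, so `D` enters the bound without a dimensional factor.
  have h2 : ‖(WithLp.toLp 2 (fun i => ∑ j : Fin m, (if i = j.castSucc then D else 0) *
      u (Sum.inr (Sum.inl j))) : EuclideanSpace ℝ (Fin (m + 1)))‖ ≤ D := by
    rw [EuclideanSpace.norm_eq, Real.sqrt_le_left hD, Fin.sum_univ_castSucc]
    have e1 : ∀ i : Fin m, ∑ j : Fin m, (if i.castSucc = j.castSucc then D else 0) *
        u (Sum.inr (Sum.inl j)) = D * u (Sum.inr (Sum.inl i)) := by
      intro i
      simp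
    have e2 : ∑ j : Fin m, (if Fin.last m = j.castSucc then D else 0) *
        u (Sum.inr (Sum.inl j)) = 0 := by
      refine Finset.sum_eq_zero fun j _ => ?_
      rw [if_neg (Fin.castSucc_lt_last j).ne', zero_mul]
    simp only [e1, e2, norm_zero, Real.norm_eq_abs, sq_abs, mul_pow, ← Finset.mul_sum]
    nlinarith [sq_nonneg D]
  have hdec : Matrix.toEuclideanLin E u =
      (WithLp.toLp 2 (fun i => ∑ j, E i (Sum.inl j) * u (Sum.inl j)) :
        EuclideanSpace ℝ (Fin (m + 1))) +
      WithLp.toLp 2 (fun i => ∑ j : Fin m, (if i = j.castSucc then D else 0) *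
        u (Sum.inr (Sum.inl j))) +
      WithLp.toLp 2 (fun i => ∑ j, M3 i j * u (Sum.inr j)) := by
    ext i
    simp only [Matrix.toLpLin_apply, Matrix.mulVec, dotProduct, Fintype.sum_sum_type,
      PiLp.add_apply, M3, Sum.elim_inl, Sum.elim_inr, sub_mul, Finset.sum_sub_distrib]
    ring
  rw [hdec]
  refine (norm_add_le _ _).trans (add_le_add ((norm_add_le _ _).trans (add_le_add h1 h2)) h3)

end NormBounds

end GrangerQuantized

namespace GrangerQuantized

/-! ### Gaussian regression and the normal equations. -/

section Regression

variable {Ω : Type*} [mΩ : MeasurableSpace Ω] {P : Measure Ω}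

/-- Least squares: the residual of the best linear predictor is orthogonal to the predictors. -/
lemma exists_orthogonal_residual {ι : Type*} [Fintype ι] {W : Ω → ℝ} {Y : ι → Ω → ℝ}
    (hW : MemLp W 2 P) (hY : ∀ i, MemLp (Y i) 2 P) :
    ∃ c : ι → ℝ, ∀ i, ∫ ω, (W ω - ∑ j, c j * Y j ω) * Y i ω ∂P = 0 := by
  let y : ι → Lp ℝ 2 P := fun i => (hY i).toLp (Y i)
  let S : Submodule ℝ (Lp ℝ 2 P) := Submodule.span ℝ (Set.range y)
  have hfin : FiniteDimensional ℝ S := FiniteDimensional.span_of_finite ℝ (Set.finite_range y)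
  obtain ⟨c, hc⟩ := (Submodule.mem_span_range_iff_exists_fun ℝ).1
    (S.starProjection_apply_mem (hW.toLp W))
  refine ⟨c, fun i => ?_⟩
  have hort := S.sub_starProjection_mem_orthogonal (hW.toLp W)
  have h := (Submodule.mem_orthogonal _ _).1 hort (y i) (Submodule.subset_span ⟨i, rfl⟩)
  rw [← hc, L2.inner_def] at h
  rw [← h]
  refine integral_congr_ae ?_
  have hs : (((∑ j, c j • y j : Lp ℝ 2 P)) : Ω → ℝ) =ᵐ[P] fun ω => ∑ j, c j * Y j ω := by
    have e : (∑ j, c j • y j : Lp ℝ 2 P) =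
        (memLp_finsetSum Finset.univ fun j _ => (hY j).const_mul (c j)).toLp
          (fun ω => ∑ j, c j * Y j ω) := by
      have e0 : ∀ s : Finset ι, (∑ j ∈ s, c j • y j : Lp ℝ 2 P) =
          (memLp_finsetSum s fun j _ => (hY j).const_mul (c j)).toLp
            (fun ω => ∑ j ∈ s, c j * Y j ω) := by
        classical
        intro s
        induction s using Finset.induction_on with
        | empty =>
          simp only [Finset.sum_empty]
          exact (MemLp.toLp_zero _).symm
        | insert a s ha ih =>
          simp only [Finset.sum_insert ha, ih]
          rfl
      exact e0 _
    rw [e]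
    exact MemLp.coeFn_toLp _
  filter_upwards [hs, Lp.coeFn_sub (hW.toLp W) (∑ j, c j • y j), hW.coeFn_toLp,
    (hY i).coeFn_toLp] with ω h1 h2 h3 h4
  rw [h2, Pi.sub_apply, h1, h3, show (y i : Ω → ℝ) ω = Y i ω from h4]
  rfl

/-- The conditional expectation of a coordinate of a centred Gaussian process given finitely many
others is linear, with residual orthogonal to them. -/
lemma exists_linear_condExp {T ι β : Type*} [Fintype ι] [MeasurableSpace β] {X : T → Ω → ℝ}
    (hX : IsGaussianProcess X P) (hmX : ∀ t, Measurable (X t)) (h0 : ∀ t, ∫ ω, X t ω ∂P = 0)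
    {W : Ω → ℝ} {Y : ι → Ω → ℝ} (hW : ∃ t, X t = W) (hY : ∀ i, ∃ t, X t = Y i)
    {V : Ω → β} {φ : (ι → ℝ) → β} (hφ : Measurable φ) (hV : V = fun ω => φ fun i => Y i ω)
    (hYV : ∀ i, Measurable[MeasurableSpace.comap V inferInstance] (Y i)) :
    ∃ c : ι → ℝ, (∀ i, ∫ ω, (W ω - ∑ j, c j * Y j ω) * Y i ω ∂P = 0) ∧
      P[W | MeasurableSpace.comap V inferInstance] =ᵐ[P] fun ω => ∑ j, c j * Y j ω := by
  have hP := hX.isProbabilityMeasure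
  obtain ⟨t, rfl⟩ := hW
  choose τ hτ using hY
  obtain rfl : (fun i => X (τ i)) = Y := funext hτ
  have hL2 : ∀ s, MemLp (X s) 2 P := fun s => (hX.hasGaussianLaw_eval s).memLp_two
  have hint : ∀ s, Integrable (X s) P := fun s => (hX.hasGaussianLaw_eval s).integrable
  obtain ⟨c, hc⟩ := exists_orthogonal_residual (hL2 t) (fun i => hL2 (τ i))
  refine ⟨c, hc, ?_⟩
  set R : Ω → ℝ := fun ω => X t ω - ∑ j, c j * X (τ j) ω with hR
  have hSint : Integrable (fun ω => ∑ j, c j * X (τ j) ω) P :=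
    integrable_finsetSum _ fun j _ => (hint _).const_mul _
  have hRint : Integrable R P := (hint t).sub hSint
  have hRm : Measurable R := by fun_prop
  have hR0 : ∫ ω, R ω ∂P = 0 := by
    rw [hR, integral_sub (hint t) hSint, h0, integral_finsetSum _ fun j _ =>
      (hint _).const_mul _]
    simp [integral_const_mul, h0]
  -- The residual is jointly Gaussian with the predictors, so orthogonality gives independence and
  -- its conditional expectation is its mean, zero.
  have hG : IsGaussianProcess (Sum.elim (fun _ : Unit => R) (fun i => X (τ i))) P := by
    classical
    refine hX.of_isGaussianProcess ?_
    rintro (_ | i)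
    · let I : Finset T := insert t (Finset.univ.image τ)
      have ht : t ∈ I := Finset.mem_insert_self _ _
      have hI : ∀ j, τ j ∈ I := fun j => Finset.mem_insert_of_mem (by simp)
      refine ⟨I, ContinuousLinearMap.proj (⟨t, ht⟩ : I) -
        ∑ j, c j • ContinuousLinearMap.proj (⟨τ j, hI j⟩ : I), fun ω => ?_⟩
      simp [hR]
    · exact ⟨{τ i}, ContinuousLinearMap.proj (⟨τ i, by simp⟩ : ({τ i} : Finset T)),
        fun ω => by simp⟩
  have hRL2 : MemLp R 2 P := (hG.hasGaussianLaw_eval (.inl ())).memLp_two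
  have hind := hG.indepFun_of_covariance_eq_zero (fun _ => hRm.aemeasurable)
    (fun i => (hmX _).aemeasurable) (fun _ i => by
      rw [covariance_eq_sub hRL2 (hL2 _), hR0, zero_mul, sub_zero]
      exact hc i)
  have hind2 : IndepFun R V P := by
    have := hind.comp (measurable_pi_apply ()) hφ
    rw [hV]
    exact this
  have hVm : Measurable V := by
    rw [hV]
    exact hφ.comp (measurable_pi_lambda _ fun i => hmX _)
  have hcR := condExp_indep_eq hRm.comap_le hVm.comap_le
    (comap_measurable R).stronglyMeasurable hind2
  have hcS : P[fun ω => ∑ j, c j * X (τ j) ω | MeasurableSpace.comap V inferInstance] =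
      fun ω => ∑ j, c j * X (τ j) ω := by
    refine condExp_of_stronglyMeasurable hVm.comap_le ?_ hSint
    refine Measurable.stronglyMeasurable ?_
    exact Finset.measurable_sum _ fun j _ => (hYV j).const_mul _
  have hsum : X t = R + fun ω => ∑ j, c j * X (τ j) ω := by
    funext ω
    simp [hR]
  rw [hsum]
  filter_upwards [condExp_add hRint hSint (MeasurableSpace.comap V inferInstance), hcR]
    with ω h1 h2
  rw [h1, Pi.add_apply, h2, hcS, hR0, zero_add]

lemma exists_extension_sum_mul (s : Finset ℕ) (c : s → ℝ) :
    ∃ c' : ℕ → ℝ, ∀ f : ℕ → ℝ, ∑ i : s, c i * f i = ∑ i ∈ s, c' i * f i := by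
  refine ⟨fun i => if h : i ∈ s then c ⟨i, h⟩ else 0, fun f => ?_⟩
  rw [← Finset.sum_coe_sort s]
  exact Finset.sum_congr rfl fun i _ => by simp

/-- Without Granger causation, the regression of `z_{k+1}` on the past involves only
`z_{k-m+1}, …, z_k`. -/
lemma exists_normal_equations [IsProbabilityMeasure P] {x z : ℕ → Ω → ℝ} {m k : ℕ}
    (hk : m ≤ k) (h : SignalPair P x z m)
    (hx0 : ∀ k, 1 ≤ k → ∫ ω, x k ω ∂P = 0) (hz0 : ∀ k, 1 ≤ k → ∫ ω, z k ω ∂P = 0)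
    (heq : ∀ᵐ ω ∂P,
      condDistrib (z (k + 1)) (fun ω => (seg x (k + 1 - m) k ω, seg z (k + 1 - m) k ω)) P
          (seg x (k + 1 - m) k ω, seg z (k + 1 - m) k ω) =
        condDistrib (z (k + 1)) (seg z 1 k) P (seg z 1 k ω)) :
    ∃ e : ℕ → ℝ,
      (∀ j ∈ Finset.Icc (k + 1 - m) k, covariance (z (k + 1)) (x j) P =
        ∑ i ∈ Finset.Icc (k + 1 - m) k, e i * covariance (z i) (x j) P) ∧
      (∀ j ∈ Finset.Icc 1 k, covariance (z (k + 1)) (z j) P =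
        ∑ i ∈ Finset.Icc (k + 1 - m) k, e i * covariance (z i) (z j) P) := by
  have hmax : max 1 (k + 1 - m) = k + 1 - m := by omega
  let G : ℕ ⊕ ℕ → Ω → ℝ := Sum.elim (fun n => x (n + 1)) (fun n => z (n + 1))
  have hG : IsGaussianProcess G P := h.gaussian
  have hGm : ∀ t, Measurable (G t) := by
    rintro (n | n)
    exacts [h.measurable_x _ (by omega), h.measurable_z _ (by omega)]
  have hG0 : ∀ t, ∫ ω, G t ω ∂P = 0 := by
    rintro (n | n)
    exacts [hx0 _ (by omega), hz0 _ (by omega)]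
  have hGx : ∀ i, 1 ≤ i → ∃ t, G t = x i := fun i hi => ⟨.inl (i - 1), by simp [G, hi]⟩
  have hGz : ∀ i, 1 ≤ i → ∃ t, G t = z i := fun i hi => ⟨.inr (i - 1), by simp [G, hi]⟩
  have hxL : ∀ i, 1 ≤ i → MemLp (x i) 2 P := by
    intro i hi
    obtain ⟨t, ht⟩ := hGx i hi
    exact ht ▸ (hG.hasGaussianLaw_eval t).memLp_two
  have hzL : ∀ i, 1 ≤ i → MemLp (z i) 2 P := by
    intro i hi
    obtain ⟨t, ht⟩ := hGz i hi
    exact ht ▸ (hG.hasGaussianLaw_eval t).memLp_two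
  have hzk := hzL (k + 1) (by omega)
  -- regression on the window of both signals
  let Y : (Finset.Icc (max 1 (k + 1 - m)) k) ⊕ (Finset.Icc (max 1 (k + 1 - m)) k) → Ω → ℝ :=
    Sum.elim (fun i => x i) (fun i => z i)
  have hpos : ∀ i : Finset.Icc (max 1 (k + 1 - m)) k, 1 ≤ (i : ℕ) := fun i =>
    le_of_max_le_left (Finset.mem_Icc.1 i.2).1
  obtain ⟨c, hc, hcE⟩ := exists_linear_condExp hG hGm hG0 (hGz (k + 1) (by omega))
    (Y := Y) (by
      rintro (i | i)
      exacts [hGx _ (hpos i), hGz _ (hpos i)])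
    (V := fun ω => (seg x (k + 1 - m) k ω, seg z (k + 1 - m) k ω))
    (φ := fun f => (fun i => f (.inl i), fun i => f (.inr i))) (by fun_prop) rfl (by
      have hV := comap_measurable (m := inferInstance) (fun ω => (seg x (k + 1 - m) k ω, seg z (k + 1 - m) k ω))
      rintro (i | i)
      · exact (measurable_pi_apply i).comp (measurable_fst.comp hV)
      · exact (measurable_pi_apply i).comp (measurable_snd.comp hV))
  -- regression on the past of `z`
  have hpos1 : ∀ i : Finset.Icc (max 1 1) k, 1 ≤ (i : ℕ) := fun i =>
    le_of_max_le_left (Finset.mem_Icc.1 i.2).1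
  obtain ⟨d, hd, hdE⟩ := exists_linear_condExp hG hGm hG0 (hGz (k + 1) (by omega))
    (Y := fun i : Finset.Icc (max 1 1) k => z i) (fun i => hGz _ (hpos1 i))
    (V := seg z 1 k) (φ := id) measurable_id rfl
    (fun i => (measurable_pi_apply i).comp (comap_measurable (seg z 1 k)))
  have hmV : Measurable (fun ω => (seg x (k + 1 - m) k ω, seg z (k + 1 - m) k ω)) :=
    (measurable_pi_lambda _ fun i => h.measurable_x _ (hpos i)).prodMk
      (measurable_pi_lambda _ fun i => h.measurable_z _ (hpos i))
  have hmZ : Measurable (seg z 1 k) := measurable_pi_lambda _ fun i => h.measurable_z _ (hpos1 i)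
  have hzi : Integrable (z (k + 1)) P := hzk.integrable one_le_two
  have e1 := condExp_ae_eq_integral_condDistrib' hmV hzi
  have e2 := condExp_ae_eq_integral_condDistrib' hmZ hzi
  obtain ⟨cx, hcx⟩ := exists_extension_sum_mul _ (fun i => c (.inl i))
  obtain ⟨cz, hcz⟩ := exists_extension_sum_mul _ (fun i => c (.inr i))
  obtain ⟨dz, hdz⟩ := exists_extension_sum_mul _ d
  have hYsum : ∀ ω, ∑ j, c j * Y j ω =
      ∑ i ∈ Finset.Icc (k + 1 - m) k, cx i * x i ω +
        ∑ i ∈ Finset.Icc (k + 1 - m) k, cz i * z i ω := by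
    intro ω
    rw [Fintype.sum_sum_type]
    exact congrArg₂ (· + ·) ((hcx fun i => x i ω).trans (by rw [hmax]))
      ((hcz fun i => z i ω).trans (by rw [hmax]))
  have hZsum : ∀ ω, ∑ j : Finset.Icc (max 1 1) k, d j * z j ω =
      ∑ i ∈ Finset.Icc 1 k, dz i * z i ω := fun ω => hdz (fun i => z i ω)
  have hsub : Finset.Icc (k + 1 - m) k ⊆ Finset.Icc 1 k :=
    Finset.Icc_subset_Icc (by omega) le_rfl
  -- Both regressions represent the mean of the same conditional law, so their difference is an
  -- almost sure linear relation. Nondegeneracy kills the `x` coefficients, equates the `z`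
  -- coefficients on the window and annihilates the older ones; the two residuals are then the same
  -- variable.
  have hrel : ∀ᵐ ω ∂P, ∑ i ∈ Finset.Icc (k + 1 - m) k, cx i * x i ω +
      ∑ i ∈ Finset.Icc 1 k, ((if i ∈ Finset.Icc (k + 1 - m) k then cz i else 0) - dz i) * z i ω
        = 0 := by
    filter_upwards [heq, e1, e2, hcE, hdE] with ω h1 h2 h3 h4 h5
    rw [h2, h1, ← h3, h5, hYsum, hZsum] at h4
    simp only [sub_mul, Finset.sum_sub_distrib, ite_mul, zero_mul]
    rw [Finset.sum_ite_mem, Finset.inter_eq_right.2 hsub, h4]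
    ring
  obtain ⟨hcx0, hcz0⟩ := h.nondegenerate k hk _ _ 0 hrel
  have hYres : ∀ ω, z (k + 1) ω - ∑ j, c j * Y j ω =
      z (k + 1) ω - ∑ i ∈ Finset.Icc (k + 1 - m) k, cz i * z i ω := by
    intro ω
    rw [hYsum, Finset.sum_eq_zero (s := Finset.Icc (k + 1 - m) k) (f := fun i => cx i * x i ω)
      (fun i hi => by rw [hcx0 i hi, zero_mul]), zero_add]
  have hZres : ∀ ω, z (k + 1) ω - ∑ j : Finset.Icc (max 1 1) k, d j * z j ω =
      z (k + 1) ω - ∑ i ∈ Finset.Icc (k + 1 - m) k, cz i * z i ω := by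
    intro ω
    rw [hZsum]
    congr 1
    calc _ = ∑ i ∈ Finset.Icc 1 k, (if i ∈ Finset.Icc (k + 1 - m) k then cz i else 0) * z i ω :=
          Finset.sum_congr rfl fun i hi => by rw [sub_eq_zero.1 (hcz0 i hi)]
      _ = _ := by
          simp only [ite_mul, zero_mul]
          rw [Finset.sum_ite_mem, Finset.inter_eq_right.2 hsub]
  simp only [hYres] at hc
  simp only [hZres] at hd
  have hcov : ∀ U : Ω → ℝ, MemLp U 2 P →
      ∫ ω, (z (k + 1) ω - ∑ i ∈ Finset.Icc (k + 1 - m) k, cz i * z i ω) * U ω ∂P = 0 →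
      covariance (z (k + 1)) U P =
        ∑ i ∈ Finset.Icc (k + 1 - m) k, cz i * covariance (z i) U P := by
    intro U hU hI
    have h1 : ∀ i ∈ Finset.Icc (k + 1 - m) k, 1 ≤ i := fun i hi =>
      (Finset.mem_Icc.1 (hsub hi)).1
    have hz : ∀ i, 1 ≤ i → covariance (z i) U P = ∫ ω, z i ω * U ω ∂P := by
      intro i hi
      rw [covariance_eq_sub (hzL i hi) hU, hz0 i hi, zero_mul, sub_zero]
      rfl
    have hi : ∀ i, 1 ≤ i → Integrable (fun ω => z i ω * U ω) P := fun i hi =>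
      (hzL i hi).integrable_mul hU
    rw [hz _ (by omega), Finset.sum_congr rfl fun i hi => by rw [hz i (h1 i hi)]]
    simp only [sub_mul, Finset.sum_mul, mul_assoc] at hI
    rw [integral_sub (hi _ (by omega)) (integrable_finsetSum _ fun i hi' =>
      (hi i (h1 i hi')).const_mul _), integral_finsetSum _ fun i hi' =>
      (hi i (h1 i hi')).const_mul _, sub_eq_zero] at hI
    simpa only [integral_const_mul] using hI
  refine ⟨cz, fun j hj => hcov _ (hxL j (Finset.mem_Icc.1 (hsub hj)).1) ?_,
    fun j hj => hcov _ (hzL j (Finset.mem_Icc.1 hj).1) ?_⟩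
  · exact hc (.inl ⟨j, by rw [hmax]; exact hj⟩)
  · exact hd ⟨j, hj⟩

end Regression

end GrangerQuantized

namespace GrangerQuantized

open Real

/-! ### Estimates for the higher-order term. -/

section OrderTerm

variable {kx kz ρxz ρzz : ℝ}

lemma exp_neg_pi_sq_mul_div_sq_le {k c : ℝ} (hk : 0 < k) (hk1 : k ≤ 1) (hc : 0 < c) :
    exp (-(π ^ 2 * c / k ^ 2)) ≤ k / c := by
  have ht : 0 < π ^ 2 * c / k ^ 2 := by positivity
  have h1 : exp (-(π ^ 2 * c / k ^ 2)) ≤ 1 / (π ^ 2 * c / k ^ 2) := by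
    rw [exp_neg, ← one_div]
    exact one_div_le_one_div_of_le ht (by linarith [add_one_le_exp (π ^ 2 * c / k ^ 2)])
  refine h1.trans ?_
  rw [one_div_div, div_le_div_iff₀ (by positivity) hc]
  have hpi : 1 ≤ π ^ 2 := by nlinarith [pi_gt_three]
  have : k * k * c ≤ k * 1 * (π ^ 2 * c) := by
    have h2 : k * k ≤ k * 1 := by gcongr
    have h3 : c ≤ π ^ 2 * c := le_mul_of_one_le_left hc.le hpi
    gcongr
  nlinarith

lemma orderTerm_pos : 0 < orderTerm kx kz ρxz ρzz := lt_max_of_lt_left (exp_pos _)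

/-- The entries of the maximum are square roots of the three kinds of entry error; this lemma and
the next two recover the errors by squaring. -/
lemma exp_le_orderTerm_sq :
    exp (-(2 * π ^ 2 * (1 / kz ^ 2))) ≤ orderTerm kx kz ρxz ρzz ^ 2 := by
  calc _ = exp (-(π ^ 2 / kz ^ 2)) ^ 2 := by rw [← exp_nat_mul]; congr 1; push_cast; ring
    _ ≤ _ := pow_le_pow_left₀ (exp_pos _).le (le_max_left _ _) 2

lemma mul_exp_le_orderTerm_sq (hx : 0 ≤ kx) (hz : 0 ≤ kz) :
    kx * kz * exp (-(2 * π ^ 2 * (1 - ρxz) * (1 / kx ^ 2 + 1 / kz ^ 2))) ≤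
      orderTerm kx kz ρxz ρzz ^ 2 := by
  calc _ = (√(kx * kz) * exp (-(π ^ 2 * (1 - ρxz) * (1 / kx ^ 2 + 1 / kz ^ 2)))) ^ 2 := by
        rw [mul_pow, sq_sqrt (mul_nonneg hx hz), ← exp_nat_mul]
        congr 2; push_cast; ring
    _ ≤ _ := pow_le_pow_left₀ (by positivity)
        ((le_max_left _ _).trans (le_max_right _ _)) 2

lemma sq_mul_exp_le_orderTerm_sq (hz : 0 ≤ kz) :
    kz * kz * exp (-(2 * π ^ 2 * (1 - ρzz) * (1 / kz ^ 2 + 1 / kz ^ 2))) ≤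
      orderTerm kx kz ρxz ρzz ^ 2 := by
  calc _ = (kz * exp (-(2 * π ^ 2 / kz ^ 2 * (1 - ρzz)))) ^ 2 := by
        rw [mul_pow, ← exp_nat_mul, sq kz]
        congr 2; push_cast; ring
    _ ≤ _ := pow_le_pow_left₀ (by positivity)
        ((le_max_right _ _).trans (le_max_right _ _)) 2

/-- Lets one factor of `orderTerm ^ 2` be paid for by `Δ_z`. The first two entries use `e^{-t} ≤
1/t`; the third already carries a factor `kz`. -/
lemma orderTerm_le (hx : 0 < kx) (hx1 : kx ≤ 1) (hz : 0 < kz) (hz1 : kz ≤ 1)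
    (hρxz : ρxz < 1) (hρzz : ρzz < 1) :
    orderTerm kx kz ρxz ρzz ≤ (1 + 1 / (1 - ρxz)) * kz := by
  have h1 : 0 < 1 - ρxz := sub_pos.2 hρxz
  have h2 : 0 < 1 - ρzz := sub_pos.2 hρzz
  have h3 : 0 < kz / (1 - ρxz) := by positivity
  have e : (1 + 1 / (1 - ρxz)) * kz = kz + kz / (1 - ρxz) := by ring
  rw [e]
  refine max_le ?_ (max_le ?_ ?_)
  · have := exp_neg_pi_sq_mul_div_sq_le hz hz1 one_pos
    rw [mul_one, div_one] at this
    linarith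
  · have hs : √(kx * kz) ≤ 1 := sqrt_le_one.2 (mul_le_one₀ hx1 hz.le hz1)
    have hexp : exp (-(π ^ 2 * (1 - ρxz) * (1 / kx ^ 2 + 1 / kz ^ 2))) ≤ kz / (1 - ρxz) := by
      refine le_trans (exp_le_exp.2 ?_) (exp_neg_pi_sq_mul_div_sq_le hz hz1 h1)
      have : 0 ≤ π ^ 2 * (1 - ρxz) * (1 / kx ^ 2) := by positivity
      rw [neg_le_neg_iff, mul_add, mul_one_div _ (kz ^ 2)]
      linarith
    calc _ ≤ 1 * (kz / (1 - ρxz)) := by gcongr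
      _ ≤ _ := by linarith
  · have : exp (-(2 * π ^ 2 / kz ^ 2 * (1 - ρzz))) ≤ 1 := by
      rw [exp_le_one_iff, neg_nonpos]; positivity
    nlinarith

end OrderTerm

section Correlation

variable {Ω : Type*} [MeasurableSpace Ω] {P : Measure Ω}

lemma stdDev_sq (U : Ω → ℝ) : stdDev P U ^ 2 = variance U P := sq_sqrt (variance_nonneg _ _)

lemma abs_covariance_le_of_abs_corr_le {U V : Ω → ℝ} {ρ : ℝ} (hU : 0 < stdDev P U)
    (hV : 0 < stdDev P V) (h : |corr P U V| ≤ ρ) :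
    |covariance U V P| ≤ ρ * (√(variance U P) * √(variance V P)) := by
  rw [corr, abs_div, abs_of_pos (mul_pos hU hV), div_le_iff₀ (mul_pos hU hV)] at h
  exact h

end Correlation

/-! ### Entrywise errors and the singular value bound for the signals. -/

section Signals

variable {Ω : Type*} [MeasurableSpace Ω] {P : Measure Ω} [IsProbabilityMeasure P]
  {x z : ℕ → Ω → ℝ} {m : ℕ}

namespace SignalPair

/-- Project the shift-invariant trajectory law to one coordinate. The relative steps are formed with
the deviation at time `1`, so it must serve for all times. -/
lemma variance_x (h : SignalPair P x z m) {n : ℕ} (hn : 1 ≤ n) :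
    variance (x n) P = variance (x 1) P := by
  have h1 := congrArg (fun μ => μ.map fun f : ℕ → ℝ × ℝ => (f 0).1) (h.stationary (n - 1))
  rw [Measure.map_map (by fun_prop) (measurable_pi_lambda _ fun i =>
      (h.measurable_x _ (by omega)).prodMk (h.measurable_z _ (by omega))),
    Measure.map_map (by fun_prop) (measurable_pi_lambda _ fun i =>
      (h.measurable_x _ (by omega)).prodMk (h.measurable_z _ (by omega)))] at h1
  simp only [Function.comp_def, zero_add, Nat.add_sub_cancel' hn] at h1
  have hx : ∀ i, 1 ≤ i → variance (x i) P = variance id (P.map (x i)) := fun i hi => by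
    rw [variance_map measurable_id.aemeasurable (h.measurable_x i hi).aemeasurable]; rfl
  rw [hx n hn, hx 1 le_rfl, h1]

lemma variance_z (h : SignalPair P x z m) {n : ℕ} (hn : 1 ≤ n) :
    variance (z n) P = variance (z 1) P := by
  have h1 := congrArg (fun μ => μ.map fun f : ℕ → ℝ × ℝ => (f 0).2) (h.stationary (n - 1))
  rw [Measure.map_map (by fun_prop) (measurable_pi_lambda _ fun i =>
      (h.measurable_x _ (by omega)).prodMk (h.measurable_z _ (by omega))),
    Measure.map_map (by fun_prop) (measurable_pi_lambda _ fun i =>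
      (h.measurable_x _ (by omega)).prodMk (h.measurable_z _ (by omega)))] at h1
  simp only [Function.comp_def, zero_add, Nat.add_sub_cancel' hn] at h1
  have hz : ∀ i, 1 ≤ i → variance (z i) P = variance id (P.map (z i)) := fun i hi => by
    rw [variance_map measurable_id.aemeasurable (h.measurable_z i hi).aemeasurable]; rfl
  rw [hz n hn, hz 1 le_rfl, h1]

lemma pair_zx (h : SignalPair P x z m)
    (hx0 : ∀ k, 1 ≤ k → ∫ ω, x k ω ∂P = 0) (hz0 : ∀ k, 1 ≤ k → ∫ ω, z k ω ∂P = 0)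
    {i j : ℕ} (hi : 1 ≤ i) (hj : 1 ≤ j) : CenteredGaussianPair P (z i) (x j) where
  law := by
    have hG : IsGaussianProcess _ P := h.gaussian
    have := hG.hasGaussianLaw_prodMk (s := .inr (i - 1)) (t := .inl (j - 1))
    simpa [Nat.sub_add_cancel hi, Nat.sub_add_cancel hj] using this
  measurable_left := h.measurable_z i hi
  measurable_right := h.measurable_x j hj
  mean_left := hz0 i hi
  mean_right := hx0 j hj

lemma pair_zz (h : SignalPair P x z m) (hz0 : ∀ k, 1 ≤ k → ∫ ω, z k ω ∂P = 0)
    {i j : ℕ} (hi : 1 ≤ i) (hj : 1 ≤ j) : CenteredGaussianPair P (z i) (z j) where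
  law := by
    have hG : IsGaussianProcess _ P := h.gaussian
    have := hG.hasGaussianLaw_prodMk (s := .inr (i - 1)) (t := .inr (j - 1))
    simpa [Nat.sub_add_cancel hi, Nat.sub_add_cancel hj] using this
  measurable_left := h.measurable_z i hi
  measurable_right := h.measurable_z j hj
  mean_left := hz0 i hi
  mean_right := hz0 j hj

/-- Without Granger causation, the causality matrix has a nonzero left null vector. -/
lemma exists_vecMul_causalityMatrix_eq_zero (h : SignalPair P x z m)
    (hx0 : ∀ k, 1 ≤ k → ∫ ω, x k ω ∂P = 0) (hz0 : ∀ k, 1 ≤ k → ∫ ω, z k ω ∂P = 0)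
    (hng : ¬ GrangerCauses P x z m) {q k : ℕ} (hq : m ≤ q) (hk : q ≤ k) :
    ∃ v : Fin (m + 1) → ℝ, v ≠ 0 ∧ Matrix.vecMul v (causalityMatrix P x z m q k) = 0 := by
  have hmk : m ≤ k := hq.trans hk
  obtain ⟨e, hex, hez⟩ := exists_normal_equations hmk h hx0 hz0 (not_not.1 hng k hmk)
  -- The regression coefficients with sign reversed, followed by `1` for `z_{k+1}`; this last entry
  -- makes the vector nonzero.
  let v : Fin (m + 1) → ℝ := Fin.snoc (fun i : Fin m => -e (k - m + 1 + i)) (1 : ℝ)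
  have hsum : ∀ U : Ω → ℝ, covariance (z (k + 1)) U P =
      ∑ i ∈ Finset.Icc (k + 1 - m) k, e i * covariance (z i) U P →
      ∑ i : Fin (m + 1), v i * covariance (z (k - m + 1 + i)) U P = 0 := by
    intro U hU
    have hI : Finset.Icc (k + 1 - m) k = Finset.Ico (k - m + 1) (k + 1) := by
      ext i; simp only [Finset.mem_Icc, Finset.mem_Ico]; omega
    rw [hI, Finset.sum_Ico_eq_sum_range, show k + 1 - (k - m + 1) = m by omega,
      ← Fin.sum_univ_eq_sum_range
        (fun i => e (k - m + 1 + i) * covariance (z (k - m + 1 + i)) U P)] at hU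
    rw [Fin.sum_univ_castSucc]
    simp only [v, Fin.snoc_castSucc, Fin.snoc_last, Fin.val_castSucc, Fin.val_last, one_mul,
      neg_mul, Finset.sum_neg_distrib]
    rw [show k - m + 1 + m = k + 1 by omega, hU]
    ring
  refine ⟨v, fun h0 => ?_, ?_⟩
  · have := congrFun h0 (Fin.last m)
    simp [v] at this
  · funext c
    rcases c with j | j | j
    · exact hsum _ (hex _ (Finset.mem_Icc.2 (by have := j.2; omega)))
    · exact hsum _ (hez _ (Finset.mem_Icc.2 (by have := j.2; omega)))
    · exact hsum _ (hez _ (Finset.mem_Icc.2 (by have := j.2; omega)))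

end SignalPair

variable {sxLo sxUp szLo szUp gxz ρxz ρzz : ℝ}

/-- The constant in front of the squared higher-order term in the quantization error of a
covariance. -/
noncomputable def entryConst (sxUp szUp gxz ρxz ρzz : ℝ) : ℝ :=
  4 * |gxz| + |sxUp| * |szUp| * gaussSumConst (2 * π ^ 2 * (1 - ρxz)) ^ 2 +
    10 * szUp ^ 2 + szUp ^ 2 * gaussSumConst (2 * π ^ 2 * (1 - ρzz)) ^ 2 + 1

/-- The summand `1` makes positivity strict, which yields `K > 0`. The absolute values are needed
because no sign is known for the bounds before a process is given. -/
lemma entryConst_pos : 0 < entryConst sxUp szUp gxz ρxz ρzz := by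
  unfold entryConst; positivity

/-- Signals with a priori bounds, together with steps small relative to the deviations. -/
structure QuantizedPair (P : Measure Ω) [IsProbabilityMeasure P] (x z : ℕ → Ω → ℝ) (m : ℕ)
    (sxLo sxUp szLo szUp gxz ρxz ρzz Δx Δz : ℝ) : Prop where
  signal : SignalPair P x z m
  mean_x : ∀ k, 1 ≤ k → ∫ ω, x k ω ∂P = 0
  mean_z : ∀ k, 1 ≤ k → ∫ ω, z k ω ∂P = 0
  bounds : APrioriBounds P x z sxLo sxUp szLo szUp gxz ρxz ρzz
  rho_xz_lt : ρxz < 1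
  rho_zz_lt : ρzz < 1
  step_x_pos : 0 < Δx
  step_z_pos : 0 < Δz
  step_x_lt : Δx < sxLo
  step_z_lt : Δz < szLo

namespace QuantizedPair

variable {Δx Δz : ℝ}

lemma gxz_nonneg (h : QuantizedPair P x z m sxLo sxUp szLo szUp gxz ρxz ρzz Δx Δz) : 0 ≤ gxz :=
  (abs_nonneg _).trans (h.bounds.cov_xz 1 1 le_rfl le_rfl)

lemma rho_xz_nonneg (h : QuantizedPair P x z m sxLo sxUp szLo szUp gxz ρxz ρzz Δx Δz) : 0 ≤ ρxz :=
  (abs_nonneg _).trans (h.bounds.corr_xz 1 1 le_rfl le_rfl)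

lemma rho_zz_nonneg (h : QuantizedPair P x z m sxLo sxUp szLo szUp gxz ρxz ρzz Δx Δz) : 0 ≤ ρzz :=
  (abs_nonneg _).trans (h.bounds.corr_zz 1 2 le_rfl one_le_two (by norm_num))

lemma step_x_lt_stdDev (h : QuantizedPair P x z m sxLo sxUp szLo szUp gxz ρxz ρzz Δx Δz)
    {i : ℕ} (hi : 1 ≤ i) : Δx < stdDev P (x i) := h.step_x_lt.trans_le (h.bounds.std_x i hi).1

lemma step_z_lt_stdDev (h : QuantizedPair P x z m sxLo sxUp szLo szUp gxz ρxz ρzz Δx Δz)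
    {i : ℕ} (hi : 1 ≤ i) : Δz < stdDev P (z i) := h.step_z_lt.trans_le (h.bounds.std_z i hi).1

lemma stdDev_x_pos (h : QuantizedPair P x z m sxLo sxUp szLo szUp gxz ρxz ρzz Δx Δz)
    {i : ℕ} (hi : 1 ≤ i) : 0 < stdDev P (x i) := h.step_x_pos.trans (h.step_x_lt_stdDev hi)

lemma stdDev_z_pos (h : QuantizedPair P x z m sxLo sxUp szLo szUp gxz ρxz ρzz Δx Δz)
    {i : ℕ} (hi : 1 ≤ i) : 0 < stdDev P (z i) := h.step_z_pos.trans (h.step_z_lt_stdDev hi)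

lemma step_x_sq_le (h : QuantizedPair P x z m sxLo sxUp szLo szUp gxz ρxz ρzz Δx Δz)
    {i : ℕ} (hi : 1 ≤ i) : Δx ^ 2 ≤ variance (x i) P := by
  rw [← stdDev_sq]
  exact pow_le_pow_left₀ h.step_x_pos.le (h.step_x_lt_stdDev hi).le 2

lemma step_z_sq_le (h : QuantizedPair P x z m sxLo sxUp szLo szUp gxz ρxz ρzz Δx Δz)
    {i : ℕ} (hi : 1 ≤ i) : Δz ^ 2 ≤ variance (z i) P := by
  rw [← stdDev_sq]
  exact pow_le_pow_left₀ h.step_z_pos.le (h.step_z_lt_stdDev hi).le 2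

lemma variance_x_div (h : QuantizedPair P x z m sxLo sxUp szLo szUp gxz ρxz ρzz Δx Δz)
    {i : ℕ} (hi : 1 ≤ i) : variance (x i) P / Δx ^ 2 = 1 / (Δx / stdDev P (x 1)) ^ 2 := by
  rw [h.signal.variance_x hi, ← stdDev_sq, div_pow, one_div_div]

lemma variance_z_div (h : QuantizedPair P x z m sxLo sxUp szLo szUp gxz ρxz ρzz Δx Δz)
    {i : ℕ} (hi : 1 ≤ i) : variance (z i) P / Δz ^ 2 = 1 / (Δz / stdDev P (z 1)) ^ 2 := by
  rw [h.signal.variance_z hi, ← stdDev_sq, div_pow, one_div_div]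

lemma variance_z_le (h : QuantizedPair P x z m sxLo sxUp szLo szUp gxz ρxz ρzz Δx Δz)
    {i : ℕ} (hi : 1 ≤ i) : variance (z i) P ≤ szUp ^ 2 := by
  rw [← stdDev_sq]
  exact pow_le_pow_left₀ (h.stdDev_z_pos hi).le (h.bounds.std_z i hi).2 2

/-- The harmonics of the `x` quantizer give `e^{-2π²/k_x²}`, which need not be dominated by
`orderTerm ^ 2` and remains a leading term. The other two errors are absorbed. -/
lemma abs_covariance_zx_sub_le
    (h : QuantizedPair P x z m sxLo sxUp szLo szUp gxz ρxz ρzz Δx Δz) {i j : ℕ}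
    (hi : 1 ≤ i) (hj : 1 ≤ j) :
    |covariance (quantizeProcess Δz z i) (quantizeProcess Δx x j) P -
        covariance (z i) (x j) P| ≤
      4 * gxz * exp (-(2 * π ^ 2 * (1 / (Δx / stdDev P (x 1)) ^ 2))) +
        entryConst sxUp szUp gxz ρxz ρzz *
          orderTerm (Δx / stdDev P (x 1)) (Δz / stdDev P (z 1)) ρxz ρzz ^ 2 := by
  have hγx := h.stdDev_x_pos le_rfl
  have hγz := h.stdDev_z_pos le_rfl
  have hx0 := h.step_x_pos
  have hz0 := h.step_z_pos
  have hcorr := h.bounds.corr_xz j i hj hi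
  have hc := abs_covariance_le_of_abs_corr_le (h.stdDev_x_pos hj) (h.stdDev_z_pos hi) hcorr
  rw [covariance_comm, mul_comm (√_)] at hc
  have hg := h.bounds.cov_xz j i hj hi
  rw [covariance_comm] at hg
  have key := (h.signal.pair_zx h.mean_x h.mean_z hi hj).abs_covariance_quantize_sub_le
    hz0 hx0 (h.step_z_sq_le hi) (h.step_x_sq_le hj) h.rho_xz_nonneg h.rho_xz_lt hc
  rw [h.variance_x_div hj, h.variance_z_div hi] at key
  refine key.trans ?_
  have hM1 := exp_le_orderTerm_sq (kx := Δx / stdDev P (x 1)) (kz := Δz / stdDev P (z 1))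
    (ρxz := ρxz) (ρzz := ρzz)
  have hM2 := mul_exp_le_orderTerm_sq (kx := Δx / stdDev P (x 1)) (kz := Δz / stdDev P (z 1))
    (ρxz := ρxz) (ρzz := ρzz) (by positivity) (by positivity)
  have hΔ : Δz * Δx ≤ |sxUp| * |szUp| * (Δx / stdDev P (x 1) * (Δz / stdDev P (z 1))) := by
    have h1 := (h.bounds.std_x 1 le_rfl).2.trans (le_abs_self sxUp)
    have h2 := (h.bounds.std_z 1 le_rfl).2.trans (le_abs_self szUp)
    calc Δz * Δx = stdDev P (x 1) * stdDev P (z 1) *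
          (Δx / stdDev P (x 1) * (Δz / stdDev P (z 1))) := by field_simp
      _ ≤ _ := by gcongr
  set kx := Δx / stdDev P (x 1)
  set kz := Δz / stdDev P (z 1)
  set M := orderTerm kx kz ρxz ρzz
  set G := gaussSumConst (2 * π ^ 2 * (1 - ρxz))
  have hg0 := h.gxz_nonneg
  have t1 : 4 * |covariance (z i) (x j) P| * exp (-(2 * π ^ 2 * (1 / kz ^ 2))) ≤
      4 * |gxz| * M ^ 2 := by
    rw [abs_of_nonneg hg0]; gcongr
  have t2 : 4 * |covariance (z i) (x j) P| * exp (-(2 * π ^ 2 * (1 / kx ^ 2))) ≤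
      4 * gxz * exp (-(2 * π ^ 2 * (1 / kx ^ 2))) := by gcongr
  have t3 : Δz * Δx * (G ^ 2 * exp (-(2 * π ^ 2 * (1 - ρxz) * (1 / kz ^ 2 + 1 / kx ^ 2)))) ≤
      |sxUp| * |szUp| * G ^ 2 * M ^ 2 := by
    rw [add_comm (1 / kz ^ 2)]
    calc _ ≤ |sxUp| * |szUp| * (kx * kz) *
          (G ^ 2 * exp (-(2 * π ^ 2 * (1 - ρxz) * (1 / kx ^ 2 + 1 / kz ^ 2)))) := by gcongr
      _ = |sxUp| * |szUp| * G ^ 2 *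
          (kx * kz * exp (-(2 * π ^ 2 * (1 - ρxz) * (1 / kx ^ 2 + 1 / kz ^ 2)))) := by ring
      _ ≤ _ := by gcongr
  have t4 : 0 ≤ (10 * szUp ^ 2 + szUp ^ 2 * gaussSumConst (2 * π ^ 2 * (1 - ρzz)) ^ 2 + 1) *
      M ^ 2 := by positivity
  rw [entryConst]
  linarith

lemma abs_covariance_zz_sub_le
    (h : QuantizedPair P x z m sxLo sxUp szLo szUp gxz ρxz ρzz Δx Δz) {i j : ℕ}
    (hi : 1 ≤ i) (hj : 1 ≤ j) (hij : i ≠ j) :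
    |covariance (quantizeProcess Δz z i) (quantizeProcess Δz z j) P -
        covariance (z i) (z j) P| ≤
      entryConst sxUp szUp gxz ρxz ρzz *
        orderTerm (Δx / stdDev P (x 1)) (Δz / stdDev P (z 1)) ρxz ρzz ^ 2 := by
  have hγz := h.stdDev_z_pos le_rfl
  have hz0 := h.step_z_pos
  have hc := abs_covariance_le_of_abs_corr_le (h.stdDev_z_pos hi) (h.stdDev_z_pos hj)
    (h.bounds.corr_zz i j hi hj hij)
  have key := (h.signal.pair_zz h.mean_z hi hj).abs_covariance_quantize_sub_le
    hz0 hz0 (h.step_z_sq_le hi) (h.step_z_sq_le hj) h.rho_zz_nonneg h.rho_zz_lt hc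
  have hg : |covariance (z i) (z j) P| ≤ szUp ^ 2 := by
    refine hc.trans ?_
    rw [h.signal.variance_z hi, h.signal.variance_z hj,
      mul_self_sqrt (variance_nonneg _ _)]
    have h1 := h.variance_z_le le_rfl
    have h2 := variance_nonneg (z 1) P
    have h3 := h.rho_zz_lt
    nlinarith
  rw [h.variance_z_div hi, h.variance_z_div hj] at key
  refine key.trans ?_
  have hM1 := exp_le_orderTerm_sq (kx := Δx / stdDev P (x 1)) (kz := Δz / stdDev P (z 1))
    (ρxz := ρxz) (ρzz := ρzz)
  have hM3 := sq_mul_exp_le_orderTerm_sq (kx := Δx / stdDev P (x 1))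
    (kz := Δz / stdDev P (z 1)) (ρxz := ρxz) (ρzz := ρzz) (by positivity)
  have hΔ : Δz * Δz ≤ szUp ^ 2 * (Δz / stdDev P (z 1) * (Δz / stdDev P (z 1))) := by
    have h1 := h.variance_z_le le_rfl
    rw [← stdDev_sq] at h1
    calc Δz * Δz = stdDev P (z 1) ^ 2 *
          (Δz / stdDev P (z 1) * (Δz / stdDev P (z 1))) := by field_simp
      _ ≤ _ := by gcongr
  set kx := Δx / stdDev P (x 1)
  set kz := Δz / stdDev P (z 1)
  set M := orderTerm kx kz ρxz ρzz
  set G := gaussSumConst (2 * π ^ 2 * (1 - ρzz))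
  have t1 : 4 * |covariance (z i) (z j) P| * exp (-(2 * π ^ 2 * (1 / kz ^ 2))) ≤
      4 * szUp ^ 2 * M ^ 2 := by gcongr
  have t3 : Δz * Δz * (G ^ 2 * exp (-(2 * π ^ 2 * (1 - ρzz) * (1 / kz ^ 2 + 1 / kz ^ 2)))) ≤
      szUp ^ 2 * G ^ 2 * M ^ 2 := by
    calc _ ≤ szUp ^ 2 * (kz * kz) *
          (G ^ 2 * exp (-(2 * π ^ 2 * (1 - ρzz) * (1 / kz ^ 2 + 1 / kz ^ 2)))) := by gcongr
      _ = szUp ^ 2 * G ^ 2 *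
          (kz * kz * exp (-(2 * π ^ 2 * (1 - ρzz) * (1 / kz ^ 2 + 1 / kz ^ 2)))) := by ring
      _ ≤ _ := by gcongr
  have t4 : 0 ≤ (4 * |gxz| + |sxUp| * |szUp| * gaussSumConst (2 * π ^ 2 * (1 - ρxz)) ^ 2 +
      2 * szUp ^ 2 + 1) * M ^ 2 := by positivity
  rw [entryConst]
  linarith

lemma abs_variance_z_sub_le
    (h : QuantizedPair P x z m sxLo sxUp szLo szUp gxz ρxz ρzz Δx Δz) {i : ℕ} (hi : 1 ≤ i) :
    |covariance (quantizeProcess Δz z i) (quantizeProcess Δz z i) P -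
        covariance (z i) (z i) P - Δz ^ 2 / 12| ≤
      entryConst sxUp szUp gxz ρxz ρzz *
        orderTerm (Δx / stdDev P (x 1)) (Δz / stdDev P (z 1)) ρxz ρzz ^ 2 := by
  have key := (h.signal.pair_zz h.mean_z hi hi).abs_variance_quantize_sub_le
    h.step_z_pos (h.step_z_sq_le hi)
  rw [h.variance_z_div hi] at key
  refine key.trans ?_
  have hM1 := exp_le_orderTerm_sq (kx := Δx / stdDev P (x 1)) (kz := Δz / stdDev P (z 1))
    (ρxz := ρxz) (ρzz := ρzz)
  have hv := h.variance_z_le hi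
  set kx := Δx / stdDev P (x 1)
  set kz := Δz / stdDev P (z 1)
  set M := orderTerm kx kz ρxz ρzz
  have t1 : 10 * variance (z i) P * exp (-(2 * π ^ 2 * (1 / kz ^ 2))) ≤
      10 * szUp ^ 2 * M ^ 2 := by gcongr
  have t4 : 0 ≤ (4 * |gxz| + |sxUp| * |szUp| * gaussSumConst (2 * π ^ 2 * (1 - ρxz)) ^ 2 +
      szUp ^ 2 * gaussSumConst (2 * π ^ 2 * (1 - ρzz)) ^ 2 + 1) * M ^ 2 := by positivity
  rw [entryConst]
  linarith

/-- Without Granger causation, the smallest singular value of the quantized causality matrix is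
at most the norm of the quantization error. -/
lemma sigmaMin_causalityMatrix_le
    (h : QuantizedPair P x z m sxLo sxUp szLo szUp gxz ρxz ρzz Δx Δz)
    (hng : ¬ GrangerCauses P x z m) (hm : 1 ≤ m) {q k : ℕ} (hq : m ≤ q) (hk : q ≤ k) :
    sigmaMin (causalityMatrix P (quantizeProcess Δx x) (quantizeProcess Δz z) m q k) ≤
      (m + 1) * (4 * gxz * exp (-(2 * π ^ 2 * (1 / (Δx / stdDev P (x 1)) ^ 2)))) +
        Δz ^ 2 / 12 + (3 * m + 2 + q) * (entryConst sxUp szUp gxz ρxz ρzz *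
          orderTerm (Δx / stdDev P (x 1)) (Δz / stdDev P (z 1)) ρxz ρzz ^ 2) := by
  obtain ⟨v, hv, hvC⟩ := h.signal.exists_vecMul_causalityMatrix_eq_zero h.mean_x h.mean_z
    hng hq hk
  obtain ⟨u, hu, hle⟩ := exists_sigmaMin_le_norm
    (causalityMatrix P (quantizeProcess Δx x) (quantizeProcess Δz z) m q k)
    (causalityMatrix P x z m q k) (by simp; omega) hv hvC
  have hb : 0 ≤ entryConst sxUp szUp gxz ρxz ρzz *
      orderTerm (Δx / stdDev P (x 1)) (Δz / stdDev P (z 1)) ρxz ρzz ^ 2 :=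
    mul_nonneg entryConst_pos.le (sq_nonneg _)
  have ha : 0 ≤ 4 * gxz * exp (-(2 * π ^ 2 * (1 / (Δx / stdDev P (x 1)) ^ 2))) :=
    mul_nonneg (mul_nonneg (by norm_num) h.gxz_nonneg) (exp_pos _).le
  have hmain := norm_blockMatrix_apply_le
    (causalityMatrix P (quantizeProcess Δx x) (quantizeProcess Δz z) m q k -
      causalityMatrix P x z m q k) (add_nonneg ha hb) hb (by positivity : 0 ≤ Δz ^ 2 / 12)
    (fun i j => h.abs_covariance_zx_sub_le (by omega) (by omega))
    (fun i j => by
      split_ifs with hij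
      · have hval : (i : ℕ) = j := by rw [hij]; simp
        simp only [Matrix.sub_apply, causalityMatrix, Sum.elim_inl, Sum.elim_inr, hval]
        exact h.abs_variance_z_sub_le (by omega)
      · rw [sub_zero]
        refine h.abs_covariance_zz_sub_le (by omega) (by omega) fun he => hij ?_
        ext
        simp only [Fin.val_castSucc]
        omega)
    -- The times of `z^o` end at `k - m`, before those of `z^*` begin, so no variance occurs in this
    -- block.
    (fun i j => h.abs_covariance_zz_sub_le (by omega) (by omega) (by have := j.2; omega)) u hu
  refine (hle.trans hmain).trans ?_
  -- The coefficient of the squared term is `(m + 1) + (2m + 1) + (q - m)`, at most `3m + 2 + q`.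
  have hcast : ((q - m : ℕ) : ℝ) ≤ q := by exact_mod_cast Nat.sub_le q m
  have := mul_le_mul_of_nonneg_right hcast hb
  linarith

end QuantizedPair

end Signals

end GrangerQuantized

/-! ### Choice of constants and conclusion. -/

theorem proposition2 (m q : ℕ) (hm : 1 ≤ m) (hq : m ≤ q)
    (sxLo sxUp szLo szUp gxz ρxz ρzz : ℝ)
    (hsx : 0 < sxLo) (hsz : 0 < szLo) (hρxz : ρxz < 1) (hρzz : ρzz < 1) :
    ∃ K : ℝ, 0 < K ∧ ∃ δ : ℝ, 0 < δ ∧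
      ∀ {Ω : Type*} [MeasurableSpace Ω] (P : Measure Ω) [IsProbabilityMeasure P]
        (x z : ℕ → Ω → ℝ),
        GrangerQuantized.SignalPair P x z m →
        (∀ k, 1 ≤ k → ∫ ω, x k ω ∂P = 0) → (∀ k, 1 ≤ k → ∫ ω, z k ω ∂P = 0) →
        GrangerQuantized.APrioriBounds P x z sxLo sxUp szLo szUp gxz ρxz ρzz →
        ∀ k : ℕ, q ≤ k → ∀ Δx Δz : ℝ, 0 < Δx → Δx < δ → 0 < Δz → Δz < δ →
          (GrangerQuantized.causalityMatrix P (GrangerQuantized.quantizeProcess Δx x)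
            (GrangerQuantized.quantizeProcess Δz z) m q k).rank = m + 1 →
          4 * (m + 1) * gxz * Real.exp (-(2 * Real.pi ^ 2 * sxLo ^ 2 / Δx ^ 2)) + Δz ^ 2 / 12 +
              GrangerQuantized.dTerm K m gxz ρxz ρzz (Δx / GrangerQuantized.stdDev P (x 1))
                (Δz / GrangerQuantized.stdDev P (z 1)) Δz <
            GrangerQuantized.sigmaMin
              (GrangerQuantized.causalityMatrix P (GrangerQuantized.quantizeProcess Δx x)
                (GrangerQuantized.quantizeProcess Δz z) m q k) →
          GrangerQuantized.GrangerCauses P x z m := by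
  have h1 : 0 < 1 - ρxz := sub_pos.2 hρxz
  have hE := GrangerQuantized.entryConst_pos (sxUp := sxUp) (szUp := szUp) (gxz := gxz)
    (ρxz := ρxz) (ρzz := ρzz)
  set E := GrangerQuantized.entryConst sxUp szUp gxz ρxz ρzz
  -- `K` is the coefficient of `M²` times the constant of `orderTerm_le`, with `4 / szLo` converting
  -- `k_z` into the square root in `d`. The choice of `δ` keeps both relative steps below `1`.
  refine ⟨4 * ((3 * m + 2 + q) * E * (1 + 1 / (1 - ρxz))) / szLo, by positivity,
    min sxLo szLo, lt_min hsx hsz, ?_⟩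
  intro Ω _ P _ x z hs hx0 hz0 hb k hk Δx Δz hΔx hΔx1 hΔz hΔz1 _ hlt
  have h : GrangerQuantized.QuantizedPair P x z m sxLo sxUp szLo szUp gxz ρxz ρzz Δx Δz :=
    ⟨hs, hx0, hz0, hb, hρxz, hρzz, hΔx, hΔz, hΔx1.trans_le (min_le_left _ _),
      hΔz1.trans_le (min_le_right _ _)⟩
  by_contra hng
  refine absurd (h.sigmaMin_causalityMatrix_le hng hm hq hk) (not_le.2 (lt_of_le_of_lt ?_ hlt))
  have hγx := h.stdDev_x_pos le_rfl
  have hγz := h.stdDev_z_pos le_rfl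
  have hg := h.gxz_nonneg
  have hkx1 : Δx / GrangerQuantized.stdDev P (x 1) ≤ 1 :=
    (div_le_one hγx).2 (h.step_x_lt_stdDev le_rfl).le
  have hkz1 : Δz / GrangerQuantized.stdDev P (z 1) ≤ 1 :=
    (div_le_one hγz).2 (h.step_z_lt_stdDev le_rfl).le
  have hM := GrangerQuantized.orderTerm_le (by positivity) hkx1 (by positivity) hkz1 hρxz hρzz
  have hM0 := GrangerQuantized.orderTerm_pos (kx := Δx / GrangerQuantized.stdDev P (x 1))
    (kz := Δz / GrangerQuantized.stdDev P (z 1)) (ρxz := ρxz) (ρzz := ρzz)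
  have hkz : Δz / GrangerQuantized.stdDev P (z 1) ≤ Δz / szLo :=
    div_le_div_of_nonneg_left hΔz.le hsz (hb.std_z 1 le_rfl).1
  have hexp : Real.exp (-(2 * Real.pi ^ 2 *
      (1 / (Δx / GrangerQuantized.stdDev P (x 1)) ^ 2))) ≤
      Real.exp (-(2 * Real.pi ^ 2 * sxLo ^ 2 / Δx ^ 2)) := by
    rw [Real.exp_le_exp, neg_le_neg_iff, div_pow, one_div_div, ← mul_div_assoc]
    have := (hb.std_x 1 le_rfl).1
    gcongr
  rw [GrangerQuantized.dTerm]
  set M := GrangerQuantized.orderTerm (Δx / GrangerQuantized.stdDev P (x 1))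
    (Δz / GrangerQuantized.stdDev P (z 1)) ρxz ρzz
  set S := √(4 * (m + 1) * gxz *
    Real.exp (-(2 * Real.pi ^ 2 / (Δx / GrangerQuantized.stdDev P (x 1)) ^ 2)) + Δz ^ 2 / 12)
  -- Because `1/16 ≤ 1/12`.
  have hS : Δz / 4 ≤ S := by
    refine Real.le_sqrt_of_sq_le ?_
    have : 0 ≤ 4 * (m + 1) * gxz *
      Real.exp (-(2 * Real.pi ^ 2 / (Δx / GrangerQuantized.stdDev P (x 1)) ^ 2)) := by positivity
    nlinarith [sq_nonneg Δz]
  have hMS : M ≤ (1 + 1 / (1 - ρxz)) * (4 * S / szLo) := by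
    refine hM.trans ?_
    have h2 : Δz / szLo ≤ 4 * S / szLo := by gcongr; linarith
    have h3 := hkz.trans h2
    gcongr
  have hlead : (m + 1) * (4 * gxz * Real.exp (-(2 * Real.pi ^ 2 *
      (1 / (Δx / GrangerQuantized.stdDev P (x 1)) ^ 2)))) ≤
      4 * (m + 1) * gxz * Real.exp (-(2 * Real.pi ^ 2 * sxLo ^ 2 / Δx ^ 2)) := by
    calc _ ≤ (m + 1) * (4 * gxz * Real.exp (-(2 * Real.pi ^ 2 * sxLo ^ 2 / Δx ^ 2))) := by gcongr
      _ = _ := by ring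
  -- One of the two factors `M` is exchanged for a multiple of `S`.
  have hhigh : (3 * m + 2 + q) * (E * M ^ 2) ≤
      S * (4 * ((3 * m + 2 + q) * E * (1 + 1 / (1 - ρxz))) / szLo * M) := by
    calc (3 * m + 2 + q) * (E * M ^ 2) = (3 * m + 2 + q) * E * M * M := by ring
      _ ≤ (3 * m + 2 + q) * E * M * ((1 + 1 / (1 - ρxz)) * (4 * S / szLo)) := by gcongr
      _ = _ := by ring
  linarith
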